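/- A computable ring is a commutative ring whose underlying set is a computable set $A\subseteq\mathbb N$ and whose operations $+$ and $\cdot$ are computable functions $A\times A\to A$. A computable presentation of a ring $A$ is a computable ring isomorphic to $A$ (by an arbitrary ring isomorphism). An index for a computable ring $B$ is a triple $e$ of programs: the first computes the characteristic function of the underlying set of $B$, and the other two compute the addition and the multiplication of $B$ on pairs of elements of $B$ (with no requirement on other inputs). A set $Z\subseteq\mathbb N$ is $\Pi^0_2$ if there is a computable $R\subseteq\mathbb N^3$ such that, for all $i$, $i\in Z\iff(\forall x)(\exists y)\,R(x,y,i)$. A set $P\subseteq\mathbb N$ is $\Pi^0_2$-complete if it is $\Pi^0_2$ and every $\Pi^0_2$ set is reducible to it by an injective computable function (so in particular many-one reducible to it). Write $\mathrm{Primes}(B)\subseteq\mathbb N$ for the set of prime elements of a computable ring $B$. **Corollary 1.6.** There exists a computable ring $A$ that is a unique factorization domain and such that $\mathrm{Primes}(B)$ is $\Pi^0_2$-complete for every computable presentation $B$ of $A$, uniformly in an index for $B$. The uniformity means the following. 1. There is one computable relation $R(e,x,y,n)$ such that, for every computable presentation $B$ of $A$, every index $e$ for $B$ and every $n\in\mathbb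 N$, $$n\in\mathrm{Primes}(B)\iff(\forall x)(\exists y)\,R(e,x,y,n).$$ 2. For every $\Pi^0_2$ set $Z\subseteq\mathbb N$ there is one partial computable function $f(e,i)$ such that, for every computable presentation $B$ of $A$ and every index $e$ for $B$, the function $i\mapsto f(e,i)$ is total and injective and satisfies, for all $i\in\mathbb N$, $$i\in Z\iff f(e,i)\in\mathrm{Primes}(B).$$ -/

import Mathlib

/-- A computable (commutative) ring: a ring whose underlying set is a computable set of natural
numbers and whose addition and multiplication are computable.  As the underlying set is computable,
a function on it is computable iff it is the restriction of a total computable function. -/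
structure ComputableRing where
  /-- the underlying set -/
  carrier : Set ℕ
  /-- the ring structure on the underlying set -/
  ring : CommRing carrier
  computable_carrier : ComputablePred fun n : ℕ => n ∈ carrier
  computable_add : ∃ f : ℕ → ℕ → ℕ, Computable₂ f ∧ ∀ a b : carrier, f a b = ((a + b : carrier) : ℕ)
  computable_mul : ∃ f : ℕ → ℕ → ℕ, Computable₂ f ∧ ∀ a b : carrier, f a b = ((a * b : carrier) : ℕ)

attribute [instance] ComputableRing.ring

namespace ComputableRing

/-- The set of prime elements, as a set of natural numbers. -/
def primes (B : ComputableRing) : Set ℕ :=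
  {n | ∃ h : n ∈ B.carrier, Prime (⟨n, h⟩ : B.carrier)}

/-- `B` is a computable presentation of the ring `A`: a computable ring isomorphic to `A`.
The isomorphism is arbitrary, not assumed computable. -/
def IsPresentationOf (B : ComputableRing) (A : Type*) [CommRing A] : Prop :=
  Nonempty (B.carrier ≃+* A)

/-- Candidates for indices of computable rings: three programs. -/
abbrev Index : Type := Nat.Partrec.Code × Nat.Partrec.Code × Nat.Partrec.Code

open Classical in
/-- The triple `e` is an index for the computable ring `B`: its three programs compute the
characteristic function of the underlying set, the addition and the multiplication (the last two
are not required to halt, or to do anything meaningful, outside the underlying set). -/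
structure IsIndex (B : ComputableRing) (e : Index) : Prop where
  carrier : ∀ n : ℕ, e.1.eval n = Part.some (if n ∈ B.carrier then 1 else 0)
  add : ∀ a b : B.carrier, e.2.1.eval (Nat.pair a b) = Part.some ((a + b : B.carrier) : ℕ)
  mul : ∀ a b : B.carrier, e.2.2.eval (Nat.pair a b) = Part.some ((a * b : B.carrier) : ℕ)

end ComputableRing

/-- `Z` is a `Π⁰₂` set. -/
def IsPi2 (Z : Set ℕ) : Prop :=
  ∃ R : ℕ → ℕ → ℕ → Prop, ComputablePred (fun t : ℕ × ℕ × ℕ => R t.1 t.2.1 t.2.2) ∧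
    ∀ i, i ∈ Z ↔ ∀ x, ∃ y, R x y i

/-- `P` is `Π⁰₂`-complete: it is `Π⁰₂`, and every `Π⁰₂` set is one-one reducible to it
(in particular, many-one reducible). -/
def IsPi2Complete (P : Set ℕ) : Prop :=
  IsPi2 P ∧ ∀ Z : Set ℕ, IsPi2 Z → OneOneReducible (fun i => i ∈ Z) (fun n => n ∈ P)

/-- Let `S e P` mean that `e` is an index for an object whose associated set is `P`.  The sets `P`
are `Π⁰₂`-complete uniformly in `e`:
one computable relation, having `e` as a parameter, gives `Π⁰₂` definitions of all of them, and for
every `Π⁰₂` set `Z` one partial computable function, having `e` as a parameter, gives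
(total, injective) reductions of `Z` to all of them. -/
def UniformlyPi2Complete {I : Type} [Primcodable I] (S : I → Set ℕ → Prop) : Prop :=
  (∃ R : I → ℕ → ℕ → ℕ → Prop,
    ComputablePred (fun t : I × ℕ × ℕ × ℕ => R t.1 t.2.1 t.2.2.1 t.2.2.2) ∧
    ∀ e P, S e P → ∀ n, n ∈ P ↔ ∀ x, ∃ y, R e x y n) ∧
  ∀ Z : Set ℕ, IsPi2 Z → ∃ f : I → ℕ →. ℕ, Partrec₂ f ∧
    ∀ e P, S e P → ∃ g : ℕ → ℕ, (∀ i, f e i = Part.some (g i)) ∧ Function.Injective g ∧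
      ∀ i, i ∈ Z ↔ g i ∈ P

/-!
Let `Z[tⱼ^±]` be the ring of Laurent polynomials over `ℤ` in variables `tⱼ`, `j : ℕ`.  Attach a
prime number `pⱼ` to every `j`, and let `D` be a set of indices on which `j ↦ pⱼ` is injective.  For
`j ∈ D` let `wⱼ` be the Gauss valuation of `pⱼ` in which the variable `tⱼ` has weight 1: the weight
of `∑ aₘ tᵐ` is the minimum of `v(aₘ) + mⱼ`, `v` being the `pⱼ`-adic valuation.  The ring is
`A = {f | wⱼ(f) ≥ 0 for all j ∈ D}`, which is generated by all `tⱼ` and `pⱼ tⱼ⁻¹`, and the `tⱼ⁻¹`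
with `j ∉ D`.

* `A` is a unique factorization domain (`Laurent.uniqueFactorizationMonoid_weightRing`).  Each
  `tⱼ` with `j ∈ D` is prime in `A`, since `wⱼ` is a valuation and `tⱼ` divides `f` iff `wⱼ(f) ≥ 1`.
  Almost all weights of a given `f ≠ 0` are zero, so a monomial normalises all of them to zero; a
  prime of the factorial ring `Z[tⱼ^±]` stays prime in `A` after normalisation.
* A prime number `q` is prime in `A` iff it is not one of the `pⱼ`, `j ∈ D`: the equation
  `pⱼ = tⱼ · (pⱼ tⱼ⁻¹)` is a proper factorization, while all other prime numbers have weight zero.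
* If the complement of `D` is computably enumerable, then `A` is generated by a computable sequence
  of terms (a generator produces `tⱼ⁻¹` once `j` has been seen to leave `D`, and `pⱼ tⱼ⁻¹` before).
  As equality of Laurent polynomials is decidable, `A` has a computable presentation
  (`Laurent.exists_computableRing_weightRing`).
* For a `Π⁰₂` property `∀ x, ∃ k, H i x k` with `H` monotone in `k`, let `D` consist of the triples
  `⟨i, x, b⟩` for which `x` is the least counterexample and `b` is the least stage by which all
  smaller `x` have been confirmed.  Its complement is computably enumerable, and `i` has at most one
  such triple, having one iff the property fails.  With the universal `Π⁰₂` set in place of the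
  property and `pⱼ` the `i`-th prime number in the sequence `primeSeq`, the `i`-th prime number is
  prime in `A` iff `i` belongs to the universal set (`exists_computableRing_prime_iff`).

Prime numbers are multiples of 1, so they can be found in any presentation, uniformly in an index,
and every isomorphism respects them; this gives the reductions.  Conversely, primes of a unique
factorization domain are its irreducible elements, and irreducibility is `Π⁰₂` uniformly in an index
(`ComputableRing.mem_primes_iff`), since being a unit is `Σ⁰₁`.
-/

/-! ### Laurent polynomials in infinitely many variables -/

/-- Laurent polynomials over `ℤ` in the variables `tⱼ`, `j : ℕ`, as the group algebra of the group
of finitely supported integer exponents. -/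
abbrev Laurent : Type := AddMonoidAlgebra ℤ (ℕ →₀ ℤ)

namespace Laurent

open AddMonoidAlgebra

/-- The monomial `∏ tⱼ ^ mⱼ`. -/
noncomputable abbrev mono (m : ℕ →₀ ℤ) : Laurent := single m 1

theorem mono_add (m n : ℕ →₀ ℤ) : mono (m + n) = mono m * mono n := by
  simp [mono, single_mul_single]

theorem mono_zero : mono 0 = 1 := rfl

theorem mono_mul_neg (m : ℕ →₀ ℤ) : mono m * mono (-m) = 1 := by
  rw [← mono_add, add_neg_cancel, mono_zero]

theorem isUnit_mono (m : ℕ →₀ ℤ) : IsUnit (mono m) :=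
  IsUnit.of_mul_eq_one _ (mono_mul_neg m)

/-- Natural exponents as integer exponents. -/
noncomputable def natExp : (ℕ →₀ ℕ) →+ (ℕ →₀ ℤ) :=
  Finsupp.mapRange.addMonoidHom (Nat.castAddMonoidHom ℤ)

theorem natExp_apply (u : ℕ →₀ ℕ) (j : ℕ) : natExp u j = u j := rfl

theorem natExp_injective : Function.Injective natExp := fun u v h => by
  ext j
  have := DFunLike.congr_fun h j
  simpa [natExp_apply] using this

/-- Every integer exponent becomes natural after adding a suitable natural exponent. -/
theorem exists_add_natExp (m : ℕ →₀ ℤ) : ∃ u v : ℕ →₀ ℕ, m + natExp u = natExp v := by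
  refine ⟨m.mapRange (fun z => (-z).toNat) rfl, m.mapRange Int.toNat rfl, ?_⟩
  ext j
  simp [natExp_apply]
  omega

/-- The ring of Laurent polynomials is factorial, being the localization of the polynomial ring at
the monomials. -/
instance uniqueFactorizationMonoid : UniqueFactorizationMonoid Laurent := by
  let φ : MvPolynomial ℕ ℤ →+* Laurent := mapDomainRingHom ℤ natExp
  let _ : Algebra (MvPolynomial ℕ ℤ) Laurent := φ.toAlgebra
  let S : Submonoid (MvPolynomial ℕ ℤ) := MonoidHom.mrange (AddMonoidAlgebra.of ℤ (ℕ →₀ ℕ))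
  have hφ : ∀ u a, φ (single u a) = single (natExp u) a := fun u a => by
    change mapDomain _ _ = _
    simp
  have hinj : Function.Injective φ := mapDomain_injective natExp_injective
  have : IsLocalization S Laurent := by
    rw [isLocalization_iff]
    refine ⟨?_, ?_, fun h => ⟨1, by rw [hinj h]⟩⟩
    · rintro ⟨_, u, rfl⟩
      change IsUnit (φ (single u.toAdd 1))
      rw [hφ]; exact isUnit_mono _
    · intro z
      suffices ∃ (x : MvPolynomial ℕ ℤ) (u : ℕ →₀ ℕ), z * mono (natExp u) = φ x by
        obtain ⟨x, u, h⟩ := this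
        refine ⟨⟨x, ⟨single u 1, ⟨.ofAdd u, rfl⟩⟩⟩, ?_⟩
        change z * φ (single u 1) = φ x
        rw [hφ, ← h]
      induction z using AddMonoidAlgebra.induction_linear with
      | zero => exact ⟨0, 0, by simp⟩
      | add f g hf hg =>
        obtain ⟨x, u, hx⟩ := hf
        obtain ⟨y, v, hy⟩ := hg
        refine ⟨x * single v 1 + y * single u 1, u + v, ?_⟩
        rw [map_add φ, map_mul φ, map_mul φ, hφ, hφ, ← hx, ← hy, map_add natExp, mono_add]
        ring
      | single m a =>
        obtain ⟨u, v, h⟩ := exists_add_natExp m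
        refine ⟨single v a, u, ?_⟩
        rw [hφ, ← h, mono, single_mul_single, mul_one]
  exact UniqueFactorizationMonoid.of_isLocalization (M := MvPolynomial ℕ ℤ) (S := S) Laurent

/-- Prime numbers are prime in the Laurent polynomial ring, because reduction modulo `q` maps to the
group algebra over the field `ZMod q`, which is a domain. -/
theorem prime_natCast {q : ℕ} (hq : q.Prime) : Prime (q : Laurent) := by
  have : Fact q.Prime := ⟨hq⟩
  let ρ : Laurent →+* AddMonoidAlgebra (ZMod q) (ℕ →₀ ℤ) :=
    mapRingHom (ℕ →₀ ℤ) (Int.castRingHom (ZMod q))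
  have hρ : ∀ f, ρ f = 0 ↔ (q : Laurent) ∣ f := by
    intro f
    constructor
    · intro h
      induction hn : f.coeff.support.card using Nat.strong_induction_on generalizing f with
      | _ n ih =>
      by_cases hf : f = 0
      · simp [hf]
      obtain ⟨m, hm⟩ : ∃ m, f.coeff m ≠ 0 := by
        by_contra! h0
        exact hf (by ext m; simpa using h0 m)
      have hd : (q : ℤ) ∣ f.coeff m := by
        have : (ρ f).coeff m = 0 := by rw [h]; rfl
        rw [coeff_mapRingHom] at this
        exact (ZMod.intCast_zmod_eq_zero_iff_dvd _ _).1 (by simpa using this)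
      obtain ⟨c, hc⟩ := hd
      have hs : single m (f.coeff m) = (q : Laurent) * single m c := by
        rw [hc, natCast_def, single_mul_single]; simp
      have he : f = single m (f.coeff m) + f.erase m := (single_add_erase m f).symm
      have hq0 : ρ (q : Laurent) = 0 := by
        rw [map_natCast, natCast_def]; simp
      have := ih _ ?_ (f.erase m) ?_ rfl
      · rw [he]
        exact dvd_add ⟨_, hs⟩ this
      · rw [← hn, coeff_erase, Finsupp.support_erase]
        exact Finset.card_erase_lt_of_mem (by simpa using hm)
      · have := h
        rw [he, hs, map_add, map_mul, hq0] at this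
        simpa using this
    · rintro ⟨g, rfl⟩
      rw [map_mul, map_natCast, natCast_def]; simp
  refine ⟨?_, ?_, ?_⟩
  · rw [natCast_def, single_ne_zero]
    exact_mod_cast hq.ne_zero
  · intro h
    have h1 := (hρ 1).2 h.dvd
    rw [map_one] at h1
    exact one_ne_zero h1
  · intro f g h
    rw [← hρ, ← hρ] at *
    rw [map_mul] at h
    exact mul_eq_zero.1 h

end Laurent

/-! ### Gauss valuations with a weighted variable -/

namespace Laurent
open AddMonoidAlgebra

/-- The weight of `f` is at least `k`, where `a · tᵐ` has weight `v(a) + mⱼ` with `v` the `p`-adic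
valuation, and the weight of `f` is the least weight of its terms.  The exponent is truncated at 0:
a monomial with `mⱼ ≥ k` imposes no condition.  The zero polynomial satisfies this for all `k`. -/
def WeightGE (p : ℕ) (j : ℕ) (k : ℤ) (f : Laurent) : Prop :=
  ∀ m, (p : ℤ) ^ (k - m j).toNat ∣ f.coeff m

/-- `f` has weight exactly `k`; in particular `f ≠ 0`. -/
def HasWeight (p : ℕ) (j : ℕ) (k : ℤ) (f : Laurent) : Prop :=
  WeightGE p j k f ∧ ¬ WeightGE p j (k + 1) f

section Weight

variable {p : ℕ} {j : ℕ} {k l : ℤ} {f g : Laurent}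

theorem WeightGE.anti (h : WeightGE p j l f) (hkl : k ≤ l) : WeightGE p j k f := fun m =>
  (pow_dvd_pow _ (by omega)).trans (h m)

theorem WeightGE.add (hf : WeightGE p j k f) (hg : WeightGE p j k g) : WeightGE p j k (f + g) :=
  fun m => dvd_add (hf m) (hg m)

theorem WeightGE.neg (hf : WeightGE p j k f) : WeightGE p j k (-f) :=
  fun m => (dvd_neg (α := ℤ)).2 (hf m)

theorem WeightGE.zero : WeightGE p j k 0 := fun _ => dvd_zero _

theorem WeightGE.single {m : ℕ →₀ ℤ} {a : ℤ} (h : (p : ℤ) ^ (k - m j).toNat ∣ a) :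
    WeightGE p j k (single m a) := fun n => by
  classical
  rw [coeff_single, Finsupp.single_apply]
  split_ifs with hmn
  · rwa [← hmn]
  · exact dvd_zero _

theorem WeightGE.mul (hf : WeightGE p j k f) (hg : WeightGE p j l g) :
    WeightGE p j (k + l) (f * g) := fun m => by
  classical
  rw [coeff_mul]
  refine Finset.dvd_sum fun a _ => Finset.dvd_sum fun b _ => ?_
  dsimp only
  split_ifs with hab
  · refine dvd_trans ?_ (mul_dvd_mul (hf a) (hg b))
    rw [← pow_add]
    refine pow_dvd_pow _ ?_
    rw [← hab, Finsupp.add_apply]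
    omega
  · exact dvd_zero _

/-- The weight of a product is the sum of the weights.  Among the pairs of monomials at which the
weights of the factors are attained there is one whose sum arises in only one way, because the group
of exponents has unique sums; at this sum nothing can cancel. -/
theorem HasWeight.mul (hp : p.Prime) (hf : HasWeight p j k f) (hg : HasWeight p j l g) :
    HasWeight p j (k + l) (f * g) := by
  classical
  refine ⟨hf.1.mul hg.1, fun hfg => ?_⟩
  -- the monomials at which the weight of `f` is attained, provided that this weight is `k`
  let T : ℤ → Laurent → Finset (ℕ →₀ ℤ) := fun k f =>
    f.coeff.support.filter fun m => ¬ (p : ℤ) ^ (k + 1 - m j).toNat ∣ f.coeff m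
  have hT : ∀ {k f}, HasWeight p j k f → (T k f).Nonempty := by
    intro k f h
    obtain ⟨m, hm⟩ := not_forall.1 h.2
    refine ⟨m, Finset.mem_filter.2 ⟨?_, hm⟩⟩
    rw [Finsupp.mem_support_iff]
    rintro h0
    exact hm (h0 ▸ dvd_zero _)
  obtain ⟨a₀, ha₀, b₀, hb₀, hu⟩ := UniqueSums.uniqueAdd_of_nonempty (hT hf) (hT hg)
  have hlow : ∀ {k f}, HasWeight p j k f → ∀ {m}, m ∈ T k f →
      m j ≤ k ∧ ∃ c, f.coeff m = (p : ℤ) ^ (k - m j).toNat * c ∧ ¬ (p : ℤ) ∣ c := by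
    intro k f h m hm
    have hm' := (Finset.mem_filter.1 hm).2
    have h1 : m j ≤ k := by
      by_contra hlt
      apply hm'
      rw [show (k + 1 - m j).toNat = 0 by omega, pow_zero]
      exact one_dvd _
    obtain ⟨c, hc⟩ := h.1 m
    refine ⟨h1, c, hc, fun hpc => hm' ?_⟩
    rw [hc, show (k + 1 - m j).toNat = (k - m j).toNat + 1 by omega, pow_succ]
    exact mul_dvd_mul_left _ hpc
  obtain ⟨ha, a, hfa, hpa⟩ := hlow hf ha₀
  obtain ⟨hb, b, hgb, hpb⟩ := hlow hg hb₀
  have key := hfg (a₀ + b₀)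
  -- all other contributions to the coefficient at `a₀ + b₀` are divisible by a higher power of `p`
  have hsum : (p : ℤ) ^ (k + l + 1 - (a₀ + b₀) j).toNat ∣
      (f * g).coeff (a₀ + b₀) - f.coeff a₀ * g.coeff b₀ := by
    have hmem : (a₀, b₀) ∈ f.coeff.support ×ˢ g.coeff.support :=
      Finset.mem_product.2 ⟨(Finset.mem_filter.1 ha₀).1, (Finset.mem_filter.1 hb₀).1⟩
    rw [coeff_mul]
    simp_rw [Finsupp.sum]
    rw [← Finset.sum_product', ← Finset.sum_erase_add _ _ hmem, if_pos rfl, add_sub_cancel_right]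
    refine Finset.dvd_sum fun c hc => ?_
    obtain ⟨hne, hc⟩ := Finset.mem_erase.1 hc
    obtain ⟨hc1, hc2⟩ := Finset.mem_product.1 hc
    split_ifs with hab
    · rw [← hab, Finsupp.add_apply]
      by_cases h1 : c.1 ∈ T k f
      · by_cases h2 : c.2 ∈ T l g
        · exact absurd (Prod.ext (hu h1 h2 hab).1 (hu h1 h2 hab).2) hne
        · have h2' : (p : ℤ) ^ (l + 1 - c.2 j).toNat ∣ g.coeff c.2 := by
            by_contra h3; exact h2 (Finset.mem_filter.2 ⟨hc2, h3⟩)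
          refine dvd_trans ?_ (mul_dvd_mul (hf.1 c.1) h2')
          rw [← pow_add]
          exact pow_dvd_pow _ (by omega)
      · have h1' : (p : ℤ) ^ (k + 1 - c.1 j).toNat ∣ f.coeff c.1 := by
          by_contra h3; exact h1 (Finset.mem_filter.2 ⟨hc1, h3⟩)
        refine dvd_trans ?_ (mul_dvd_mul h1' (hg.1 c.2))
        rw [← pow_add]
        exact pow_dvd_pow _ (by omega)
    · exact dvd_zero _
  have hprod := (dvd_sub_right key).1 hsum
  rw [hfa, hgb, Finsupp.add_apply,
    show (k + l + 1 - (a₀ j + b₀ j)).toNat = (k - a₀ j).toNat + (l - b₀ j).toNat + 1 by omega,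
    show (p : ℤ) ^ (k - a₀ j).toNat * a * ((p : ℤ) ^ (l - b₀ j).toNat * b) =
      (p : ℤ) ^ ((k - a₀ j).toNat + (l - b₀ j).toNat) * (a * b) by rw [pow_add]; ring,
    pow_succ] at hprod
  have hpz : Prime (p : ℤ) := Nat.prime_iff_prime_int.1 hp
  have := (mul_dvd_mul_iff_left (pow_ne_zero _ hpz.ne_zero)).1 hprod
  rcases hpz.dvd_or_dvd this with h | h
  exacts [hpa h, hpb h]

theorem HasWeight.le (hf : HasWeight p j k f) (hl : WeightGE p j l f) : l ≤ k := by
  by_contra h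
  exact hf.2 (hl.anti (by omega))

theorem HasWeight.unique (hf : HasWeight p j k f) (hl : HasWeight p j l f) : k = l :=
  le_antisymm (hl.le hf.1) (hf.le hl.1)

theorem HasWeight.ne_zero (hf : HasWeight p j k f) : f ≠ 0 := by
  rintro rfl; exact hf.2 .zero

/-- Every nonzero Laurent polynomial has a weight. -/
theorem exists_hasWeight (hp : p.Prime) (j : ℕ) (hf : f ≠ 0) : ∃ k, HasWeight p j k f := by
  have hb : ∃ b : ℤ, ∀ k, WeightGE p j k f → k ≤ b := by
    obtain ⟨m, hm⟩ : ∃ m, f.coeff m ≠ 0 := by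
      by_contra! h0
      exact hf (by ext m; simpa using h0 m)
    refine ⟨(f.coeff m).natAbs + m j, fun k hk => ?_⟩
    have h1 := Int.natAbs_dvd_natAbs.2 (hk m)
    rw [Int.natAbs_pow, Int.natAbs_natCast] at h1
    have h2 := Nat.le_of_dvd (Int.natAbs_pos.2 hm) h1
    have h3 := (Nat.lt_pow_self hp.one_lt (n := (k - m j).toNat)).trans_le h2
    omega
  have hne : ∃ k, WeightGE p j k f := by
    classical
    by_cases hs : f.coeff.support.Nonempty
    · obtain ⟨m, -, hm⟩ := Finset.exists_min_image f.coeff.support (fun m => m j) hs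
      refine ⟨m j, fun n => ?_⟩
      by_cases hn : n ∈ f.coeff.support
      · have := hm n hn
        rw [show (m j - n j).toNat = 0 by omega, pow_zero]
        exact one_dvd _
      · rw [Finsupp.notMem_support_iff.1 hn]
        exact dvd_zero _
    · exact absurd (by simpa using hs) hf
  obtain ⟨k, hk, hmax⟩ := Int.exists_greatest_of_bdd hb hne
  exact ⟨k, hk, fun h => by have := hmax _ h; omega⟩

theorem hasWeight_mono (hp : p.Prime) (j : ℕ) (m : ℕ →₀ ℤ) : HasWeight p j (m j) (mono m) := by
  refine ⟨.single (by simp), fun h => ?_⟩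
  have := h m
  simp [mono, coeff_single] at this
  exact hp.one_lt.ne' (by simpa using Int.natCast_dvd.1 this)

/-- Dividing by an element of weight `k` lowers the weight by `k`. -/
theorem HasWeight.of_mul (hp : p.Prime) (hf : HasWeight p j k f)
    (hfg : WeightGE p j (k + l) (f * g)) : WeightGE p j l g := by
  by_cases hg : g = 0
  · exact hg ▸ .zero
  obtain ⟨n, hn⟩ := exists_hasWeight hp j hg
  have := (hf.mul hp hn).le hfg
  exact hn.1.anti (by omega)

end Weight

/-- Only finitely many weights of a given nonzero Laurent polynomial are nonzero: the `j`-th one can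
be nonzero only if `tⱼ` occurs or `p j` divides a fixed nonzero coefficient. -/
theorem finite_setOf_not_hasWeight_zero {D : Set ℕ} {p : ℕ → ℕ} (hp : ∀ j, (p j).Prime)
    (hinj : Set.InjOn p D) {f : Laurent} (hf : f ≠ 0) :
    {j ∈ D | ¬ HasWeight (p j) j 0 f}.Finite := by
  classical
  obtain ⟨m, hm⟩ : ∃ m, f.coeff m ≠ 0 := by
    by_contra! h0
    exact hf (by ext m; simpa using h0 m)
  have h1 : {j ∈ D | p j ∈ (f.coeff m).natAbs.primeFactors}.Finite := by
    refine Set.Finite.of_finite_image (f := p)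
      (((f.coeff m).natAbs.primeFactors.finite_toSet).subset ?_) (hinj.mono fun j hj => hj.1)
    rintro _ ⟨j, hj, rfl⟩
    exact hj.2
  refine (h1.union (f.coeff.support.biUnion Finsupp.support).finite_toSet).subset ?_
  rintro j ⟨hjD, hj⟩
  by_contra hnot
  rw [Set.mem_union, not_or] at hnot
  obtain ⟨hn1, hn2⟩ := hnot
  have hzero : ∀ n ∈ f.coeff.support, n j = 0 := by
    intro n hn
    by_contra h
    exact hn2 (Finset.mem_coe.2 (Finset.mem_biUnion.2 ⟨n, hn, Finsupp.mem_support_iff.2 h⟩))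
  refine hj ⟨fun n => ?_, fun h => hn1 ⟨hjD, ?_⟩⟩
  · by_cases hn : n ∈ f.coeff.support
    · simp [hzero n hn]
    · rw [Finsupp.notMem_support_iff.1 hn]
      exact dvd_zero _
  · have := h m
    rw [hzero m (Finsupp.mem_support_iff.2 hm)] at this
    simp only [zero_add, sub_zero, Int.toNat_one, pow_one] at this
    exact Nat.mem_primeFactors.2 ⟨hp j, Int.natCast_dvd.1 this, Int.natAbs_ne_zero.2 hm⟩

end Laurent

/-! ### The ring of elements of nonnegative weights, and its primes -/

namespace Laurent
open AddMonoidAlgebra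

/-- `a` is a product of primes, up to a unit. -/
def HasPrimeFactors {R : Type*} [CommRing R] (a : R) : Prop :=
  ∃ s : Multiset R, (∀ b ∈ s, Prime b) ∧ Associated s.prod a

namespace HasPrimeFactors

variable {R : Type*} [CommRing R] {a b : R}

theorem of_isUnit (h : IsUnit a) : HasPrimeFactors a :=
  ⟨0, by simp, by simpa using (associated_one_iff_isUnit.2 h).symm⟩

theorem of_prime (h : Prime a) : HasPrimeFactors a :=
  ⟨{a}, by simpa using h, by simp⟩

theorem mul (ha : HasPrimeFactors a) (hb : HasPrimeFactors b) : HasPrimeFactors (a * b) := by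
  obtain ⟨s, hs, hsa⟩ := ha
  obtain ⟨t, ht, htb⟩ := hb
  refine ⟨s + t, fun c hc => ?_, ?_⟩
  · rcases Multiset.mem_add.1 hc with h | h
    exacts [hs c h, ht c h]
  · rw [Multiset.prod_add]
    exact hsa.mul_mul htb

theorem pow (ha : HasPrimeFactors a) (n : ℕ) : HasPrimeFactors (a ^ n) := by
  induction n with
  | zero => exact of_isUnit (by simp)
  | succ n ih => rw [pow_succ]; exact ih.mul ha

end HasPrimeFactors

/-- The Laurent polynomials whose weights for `p j` and `tⱼ` are nonnegative for all `j ∈ D`. -/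
noncomputable def weightRing (D : Set ℕ) (p : ℕ → ℕ) : Subring Laurent where
  carrier := {f | ∀ j ∈ D, WeightGE (p j) j 0 f}
  zero_mem' _ _ := .zero
  one_mem' j _ := .single (by simp)
  add_mem' hf hg j hj := (hf j hj).add (hg j hj)
  neg_mem' hf j hj := (hf j hj).neg
  mul_mem' hf hg j hj := (hf j hj).mul (hg j hj)

section

variable {D : Set ℕ} {p : ℕ → ℕ}

theorem inv_gen_mem (j : ℕ) : single (-Finsupp.single j 1) (p j : ℤ) ∈ weightRing D p :=
  fun i _ => .single (by
    by_cases h : j = i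
    · subst h; simp
    · simp [h])

variable (hp : ∀ j, (p j).Prime)
include hp

theorem mono_mem_iff {m : ℕ →₀ ℤ} : mono m ∈ weightRing D p ↔ ∀ j ∈ D, 0 ≤ m j :=
  ⟨fun h j hj => (hasWeight_mono (hp j) j m).le (h j hj),
    fun h j hj => (hasWeight_mono (hp j) j m).1.anti (h j hj)⟩

/-- An element all of whose weights are zero divides in the subring what it divides in the Laurent
polynomial ring. -/
theorem dvd_of_normal {f g : weightRing D p}
    (hf : ∀ j ∈ D, HasWeight (p j) j 0 (f : Laurent)) (h : (f : Laurent) ∣ g) : f ∣ g := by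
  obtain ⟨h, hh⟩ := h
  refine ⟨⟨h, fun j hj => (hf j hj).of_mul (hp j) ?_⟩, Subtype.ext hh⟩
  rw [← hh, add_zero]
  exact g.2 j hj

/-- A prime of the Laurent polynomial ring all of whose weights are zero stays prime in the
subring. -/
theorem prime_of_normal {f : weightRing D p}
    (hf : ∀ j ∈ D, HasWeight (p j) j 0 (f : Laurent)) (h : Prime (f : Laurent)) : Prime f := by
  refine ⟨fun h0 => h.ne_zero (by rw [h0]; rfl),
    fun hu => h.not_isUnit (hu.map (weightRing D p).subtype), ?_⟩
  intro a b hab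
  have : (f : Laurent) ∣ a * b := map_dvd (weightRing D p).subtype hab
  exact (h.dvd_or_dvd this).imp (dvd_of_normal hp hf) (dvd_of_normal hp hf)

theorem gen_mem (j : ℕ) : mono (Finsupp.single j 1) ∈ weightRing D p :=
  (mono_mem_iff hp).2 fun i _ => by
    by_cases h : j = i <;> simp [h]

/-- For `j ∈ D`, the variable `tⱼ` divides exactly the elements of positive weight at `j`. -/
theorem gen_dvd_iff {j : ℕ} (hj : j ∈ D) (g : weightRing D p) :
    (⟨mono (Finsupp.single j 1), gen_mem hp j⟩ : weightRing D p) ∣ g ↔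
      WeightGE (p j) j 1 (g : Laurent) := by
  constructor
  · rintro ⟨h, rfl⟩
    have := (hasWeight_mono (hp j) j (Finsupp.single j 1)).1.mul (h.2 j hj)
    simpa using this
  · intro hg
    have hmul : mono (Finsupp.single j 1) * (mono (-Finsupp.single j 1) * g) = (g : Laurent) := by
      rw [← mul_assoc, mono_mul_neg, one_mul]
    refine ⟨⟨mono (-Finsupp.single j 1) * g, fun i hi => ?_⟩, Subtype.ext hmul.symm⟩
    refine (hasWeight_mono (hp i) i (Finsupp.single j 1)).of_mul (hp i) ?_
    rw [hmul]
    by_cases h : j = i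
    · subst h; simpa using hg
    · simpa [Finsupp.single_apply, h] using g.2 i hi

theorem prime_gen {j : ℕ} (hj : j ∈ D) :
    Prime (⟨mono (Finsupp.single j 1), gen_mem hp j⟩ : weightRing D p) := by
  refine ⟨fun h => ?_, fun h => ?_, fun a b hab => ?_⟩
  · exact (hasWeight_mono (hp j) j (Finsupp.single j 1)).ne_zero (congrArg Subtype.val h)
  · have := (gen_dvd_iff hp hj 1).1 h.dvd
    have := (hasWeight_mono (hp j) j 0).le this
    simp at this
  · simp only [gen_dvd_iff hp hj] at hab ⊢
    by_contra! h
    have ha : HasWeight (p j) j 0 (a : Laurent) := ⟨a.2 j hj, by simpa using h.1⟩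
    have hb : HasWeight (p j) j 0 (b : Laurent) := ⟨b.2 j hj, by simpa using h.2⟩
    have := (ha.mul (hp j) hb).le hab
    simp at this

/-- The monomials in the subring are products of primes `tⱼ` with `j ∈ D` and of units `tⱼ ^ n` with
`j ∉ D`. -/
theorem hasPrimeFactors_mono (m : ℕ →₀ ℤ) (hm : mono m ∈ weightRing D p) :
    HasPrimeFactors (⟨mono m, hm⟩ : weightRing D p) := by
  induction m using Finsupp.induction with
  | zero => exact .of_isUnit (isUnit_one (M := weightRing D p))
  | single_add j n m hjm hn ih =>
    rw [mono_mem_iff hp] at hm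
    have hjm : m j = 0 := Finsupp.notMem_support_iff.1 hjm
    have hm' : mono m ∈ weightRing D p := (mono_mem_iff hp).2 fun i hi => by
      have := hm i hi
      by_cases h : j = i
      · subst h; exact hjm.ge
      · simpa [Finsupp.single_apply, h] using this
    have h1 : mono (Finsupp.single j n) ∈ weightRing D p := (mono_mem_iff hp).2 fun i hi => by
      have := hm i hi
      by_cases h : j = i
      · subst h; simpa [hjm] using this
      · simp [h]
    have h2 : HasPrimeFactors (⟨mono (Finsupp.single j n), h1⟩ : weightRing D p) := by
      by_cases hj : j ∈ D
      · have hn : 0 ≤ n := by simpa using (mono_mem_iff hp).1 h1 j hj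
        obtain ⟨n, rfl⟩ := Int.eq_ofNat_of_zero_le hn
        convert (HasPrimeFactors.of_prime (prime_gen hp hj)).pow n
        simp [mono, single_pow]
      · refine .of_isUnit (IsUnit.of_mul_eq_one ⟨mono (-Finsupp.single j n), ?_⟩
          (Subtype.ext (mono_mul_neg _)))
        refine (mono_mem_iff hp).2 fun i hi => ?_
        have : j ≠ i := fun h => hj (h ▸ hi)
        simp [this]
    have := h2.mul (ih hm')
    convert this
    exact mono_add _ _

/-- The factorization `p j = tⱼ · (p j · tⱼ⁻¹)` is proper if `j ∈ D`. -/
theorem not_prime_natCast {j : ℕ} (hj : j ∈ D) : ¬ Prime ((p j : ℕ) : weightRing D p) := by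
  intro h
  have hx := inv_gen_mem (D := D) (p := p) j
  have hmul : ((p j : ℕ) : weightRing D p) =
      ⟨mono (Finsupp.single j 1), gen_mem hp j⟩ * ⟨_, hx⟩ := Subtype.ext <| by
    push_cast
    simp [mono, single_mul_single, natCast_def]
  rcases h.irreducible.isUnit_or_isUnit hmul with hu | hu
  · exact (prime_gen hp hj).not_isUnit hu
  · have hu' := (hu.map (weightRing D p).subtype).mul (isUnit_mono (Finsupp.single j 1))
    refine (prime_natCast (hp j)).not_isUnit ?_
    have heq : (p j : Laurent) =
        single (-Finsupp.single j 1) (p j : ℤ) * mono (Finsupp.single j 1) := by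
      simp [mono, single_mul_single, natCast_def]
    rw [heq]
    exact hu'

theorem prime_natCast_weightRing {q : ℕ} (hq : q.Prime) (hqD : ∀ j ∈ D, p j ≠ q) :
    Prime ((q : ℕ) : weightRing D p) := by
  refine prime_of_normal hp (fun j hj => ⟨((q : ℕ) : weightRing D p).2 j hj, fun h => ?_⟩) ?_
  · have := h 0
    simp [natCast_def, coeff_single] at this
    exact hqD j hj ((Nat.prime_dvd_prime_iff_eq (hp j) hq).1 (by exact_mod_cast this))
  · simpa using prime_natCast hq

variable (hinj : Set.InjOn p D)
include hinj

/-- Multiplication by a suitable monomial makes all weights of a nonzero element zero. -/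
theorem exists_normalize {f : Laurent} (hf : f ≠ 0) :
    ∃ m : ℕ →₀ ℤ, ∀ j ∈ D, HasWeight (p j) j 0 (f * mono m) := by
  classical
  choose w hw using fun j => exists_hasWeight (hp j) j hf
  refine ⟨Finsupp.onFinset (finite_setOf_not_hasWeight_zero hp hinj hf).toFinset
    (fun j => if j ∈ D then - w j else 0) ?_, fun j hj => ?_⟩
  · intro j hj
    rw [Set.Finite.mem_toFinset]
    by_cases hjD : j ∈ D
    · refine ⟨hjD, fun h => ?_⟩
      rw [if_pos hjD, (hw j).unique h] at hj
      simp at hj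
    · simp [hjD] at hj
  · convert (hw j).mul (hp j) (hasWeight_mono (hp j) j _)
    simp [hj]

/-- Normalised elements are products of primes.  This is inherited, factor by factor, from the prime
factorization in the Laurent polynomial ring. -/
theorem exists_normalize_hasPrimeFactors {f : Laurent} (hf : f ≠ 0) :
    ∃ m : ℕ →₀ ℤ, ∃ h : ∀ j ∈ D, HasWeight (p j) j 0 (f * mono m),
      HasPrimeFactors (⟨f * mono m, fun j hj => (h j hj).1⟩ : weightRing D p) := by
  induction f using UniqueFactorizationMonoid.induction_on_prime with
  | h₁ => exact absurd rfl hf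
  | h₂ x hx =>
    obtain ⟨m, hm⟩ := exists_normalize hp hinj hf
    obtain ⟨y, hy⟩ := (hx.mul (isUnit_mono m)).exists_right_inv
    refine ⟨m, hm, .of_isUnit (IsUnit.of_mul_eq_one ⟨y, fun j hj => ?_⟩ (Subtype.ext hy))⟩
    refine (hm j hj).of_mul (hp j) ?_
    rw [hy]
    exact .single (by simp)
  | h₃ a q ha hq ih =>
    obtain ⟨m, hm, hfm⟩ := ih ha
    obtain ⟨n, hn⟩ := exists_normalize hp hinj hq.ne_zero
    have hpr : Prime (⟨q * mono n, fun j hj => (hn j hj).1⟩ : weightRing D p) :=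
      prime_of_normal hp hn ((associated_mul_unit_right q _ (isUnit_mono n)).prime hq)
    have heq : q * a * mono (n + m) = q * mono n * (a * mono m) := by
      rw [mono_add]; ring
    refine ⟨n + m, fun j hj => ?_, ?_⟩
    · rw [heq]
      exact (hn j hj).mul (hp j) (hm j hj)
    · convert (HasPrimeFactors.of_prime hpr).mul hfm
      exact Subtype.ext heq

theorem uniqueFactorizationMonoid_weightRing : UniqueFactorizationMonoid (weightRing D p) := by
  refine UniqueFactorizationMonoid.of_exists_prime_factors fun a ha => ?_
  have ha' : (a : Laurent) ≠ 0 := fun h => ha (Subtype.ext h)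
  obtain ⟨m, hm, hf⟩ := exists_normalize_hasPrimeFactors hp hinj ha'
  have hmul : (a : Laurent) * mono m * mono (-m) = a := by
    rw [mul_assoc, mono_mul_neg, mul_one]
  have hmem : mono (-m) ∈ weightRing D p := fun j hj =>
    (hm j hj).of_mul (hp j) (by rw [hmul]; exact a.2 j hj)
  change HasPrimeFactors a
  convert hf.mul (hasPrimeFactors_mono hp (-m) hmem)
  exact Subtype.ext hmul.symm

end

end Laurent

/-! ### Generators of the ring -/

namespace Laurent
open AddMonoidAlgebra

/-- The elements `tⱼ` and `p j · tⱼ⁻¹` for all `j`, and `tⱼ⁻¹` for `j ∉ D`. -/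
def weightGens (D : Set ℕ) (p : ℕ → ℕ) : Set Laurent :=
  {f | ∃ j, f = mono (Finsupp.single j 1) ∨
    f = single (-Finsupp.single j 1) (p j : ℤ) ∨ j ∉ D ∧ f = mono (-Finsupp.single j 1)}

variable {D : Set ℕ} {p : ℕ → ℕ}

/-- The terms of nonnegative weights are products of generators.  The powers of the primes `p j` that
are needed divide the coefficient together, as these primes are distinct. -/
theorem single_mem_closure (hp : ∀ j, (p j).Prime) (hinj : Set.InjOn p D) (m : ℕ →₀ ℤ) :
    ∀ a : ℤ, (∀ j ∈ D, (p j : ℤ) ^ (-m j).toNat ∣ a) →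
      single m a ∈ Subring.closure (weightGens D p) := by
  have hgen : ∀ j, mono (Finsupp.single j 1) ∈ Subring.closure (weightGens D p) :=
    fun j => Subring.subset_closure ⟨j, .inl rfl⟩
  have hinv : ∀ j, single (-Finsupp.single j 1) (p j : ℤ) ∈ Subring.closure (weightGens D p) :=
    fun j => Subring.subset_closure ⟨j, .inr (.inl rfl)⟩
  have hout : ∀ j, j ∉ D → mono (-Finsupp.single j 1) ∈ Subring.closure (weightGens D p) :=
    fun j hj => Subring.subset_closure ⟨j, .inr (.inr ⟨hj, rfl⟩)⟩
  induction m using Finsupp.induction with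
  | zero =>
    intro a _
    have : single 0 a = (a : Laurent) := by simp [intCast_def]
    rw [this]
    exact intCast_mem _ a
  | single_add j n m hjm hn ih =>
    intro a ha
    have hjm : m j = 0 := Finsupp.notMem_support_iff.1 hjm
    have hrest : ∀ i ∈ D, i ≠ j → (p i : ℤ) ^ (-m i).toNat ∣ a := fun i hi hij => by
      simpa [Ne.symm hij] using ha i hi
    by_cases hn0 : 0 ≤ n
    · obtain ⟨n, rfl⟩ := Int.eq_ofNat_of_zero_le hn0
      have : single (Finsupp.single j (n : ℤ) + m) a =
          mono (Finsupp.single j 1) ^ n * single m a := by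
        simp [mono, single_pow, single_mul_single]
      rw [this]
      refine mul_mem (pow_mem (hgen j) n) (ih a fun i hi => ?_)
      by_cases hij : i = j
      · subst hij; simp [hjm]
      · exact hrest i hi hij
    · obtain ⟨k, rfl⟩ : ∃ k : ℕ, n = -k := ⟨(-n).toNat, by omega⟩
      by_cases hj : j ∈ D
      · obtain ⟨c, rfl⟩ : (p j : ℤ) ^ k ∣ a := by simpa [hjm] using ha j hj
        have : single (Finsupp.single j (-(k : ℤ)) + m) ((p j : ℤ) ^ k * c) =
            single (-Finsupp.single j 1) (p j : ℤ) ^ k * single m c := by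
          simp [single_pow, single_mul_single]
        rw [this]
        refine mul_mem (pow_mem (hinv j) k) (ih c fun i hi => ?_)
        by_cases hij : i = j
        · subst hij; simp [hjm]
        · refine IsCoprime.dvd_of_dvd_mul_left ?_ (hrest i hi hij)
          refine IsCoprime.pow (Nat.isCoprime_iff_coprime.2 ?_)
          exact (Nat.coprime_primes (hp i) (hp j)).2 fun h => hij (hinj hi hj h)
      · have : single (Finsupp.single j (-(k : ℤ)) + m) a =
            mono (-Finsupp.single j 1) ^ k * single m a := by
          simp [mono, single_pow, single_mul_single]
        rw [this]
        refine mul_mem (pow_mem (hout j hj) k) (ih a fun i hi => ?_)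
        by_cases hij : i = j
        · exact absurd (hij ▸ hi) hj
        · exact hrest i hi hij

theorem closure_weightGens (hp : ∀ j, (p j).Prime) (hinj : Set.InjOn p D) :
    Subring.closure (weightGens D p) = weightRing D p := by
  refine le_antisymm (Subring.closure_le.2 ?_) fun f hf => ?_
  · rintro _ ⟨j, rfl | rfl | ⟨hj, rfl⟩⟩
    · exact gen_mem hp j
    · exact inv_gen_mem j
    · refine (mono_mem_iff hp).2 fun i hi => ?_
      have : j ≠ i := fun h => hj (h ▸ hi)
      simp [this]
  · rw [← f.sum_coeff_single]
    refine sum_mem fun m _ => single_mem_closure hp hinj m _ fun j hj => ?_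
    simpa using hf j hj m

end Laurent

/-! ### Computable presentations from codes of elements -/

/-- A ring has a computable presentation if its elements have codes, possibly many for each, on which
the operations are computable and equality is decidable.  The underlying set of the presentation
consists of the least codes. -/
theorem ComputableRing.exists_of_codes {R T : Type*} [CommRing R] [Primcodable T] [Inhabited T]
    (val : T → R) (hval : Function.Surjective val) (add mul : T → T → T)
    (hadd : ∀ s t, val (add s t) = val s + val t) (hmul : ∀ s t, val (mul s t) = val s * val t)
    (cadd : Computable₂ add) (cmul : Computable₂ mul)
    (ceq : ComputablePred fun t : T × T => val t.1 = val t.2) :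
    ∃ A : ComputableRing, Nonempty (A.carrier ≃+* R) := by
  classical
  let dec : ℕ → T := fun n => (Encodable.decode n).getD default
  have cdec : Computable dec := Computable.option_getD Computable.decode (Computable.const _)
  have hdec : ∀ t, dec (Encodable.encode t) = t := fun t => by simp [dec]
  -- natural numbers as codes; those that are no code of an element of `T` are given a junk value
  let v : ℕ → R := fun n => val (dec n)
  have hv : ∀ r, ∃ k, v k = r := fun r => by
    obtain ⟨t, rfl⟩ := hval r
    exact ⟨Encodable.encode t, by simp only [v, hdec]⟩
  let least : R → ℕ := fun r => Nat.find (hv r)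
  have hleast : ∀ r, v (least r) = r := fun r => Nat.find_spec (hv r)
  have crep : Computable fun n => least (v n) := by
    refine Computable.find (P := fun n k => v k = v n) ?_ (fun n => hv (v n))
    obtain ⟨_, h⟩ := ceq
    exact ⟨fun _ => inferInstance,
      (h.comp ((cdec.comp Computable.snd).pair (cdec.comp Computable.fst))).of_eq
        fun _ => by congr⟩
  let C : Set ℕ := {n | least (v n) = n}
  let e : C ≃ R :=
    { toFun := fun n => v n
      invFun := fun r => ⟨least r, congrArg least (hleast r)⟩
      left_inv := fun n => Subtype.ext n.2
      right_inv := hleast }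
  have hbin : ∀ {op : T → T → T} {op' : R → R → R}, (∀ s t, val (op s t) = op' (val s) (val t)) →
      Computable₂ op → ∃ f : ℕ → ℕ → ℕ, Computable₂ f ∧
        ∀ a b : C, f a b = ((e.symm (op' (e a) (e b)) : C) : ℕ) := by
    intro op op' hop cop
    refine ⟨fun m n => least (v (Encodable.encode (op (dec m) (dec n)))), ?_, fun a b => ?_⟩
    · exact crep.comp (Computable.encode.comp
        (cop.comp (cdec.comp Computable.fst) (cdec.comp Computable.snd)))
    · simp only [v, hdec, hop]
      rfl
  let _ := e.commRing
  exact ⟨{ carrier := C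
           ring := e.commRing
           computable_carrier := ⟨fun _ => inferInstance,
             (Primrec.eq.decide.to_comp.comp crep Computable.id).of_eq fun n => by congr⟩
           computable_add := hbin hadd cadd
           computable_mul := hbin hmul cmul }, ⟨e.ringEquiv⟩⟩

/-! ### Decidability of equality of sums of terms -/

namespace Laurent
open AddMonoidAlgebra

/-- Codes of terms: `(c, d, a, b)` has coefficient `c - d`, and its monomial is a fraction with
numerator coded by `a` and denominator coded by `b`; see `Laurent.Term.Codes`. -/
abbrev Term : Type := ℕ × ℕ × ℕ × ℕ

namespace Term

/-- The code of a product of terms. -/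
def mul (s t : Term) : Term :=
  (s.1 * t.1 + s.2.1 * t.2.1, s.1 * t.2.1 + s.2.1 * t.1, s.2.2.1 * t.2.2.1, s.2.2.2 * t.2.2.2)

/-- Two codes have the same monomial: equality of fractions, by cross-multiplication. -/
def Same (s t : Term) : Prop := s.2.2.1 * t.2.2.2 = t.2.2.1 * s.2.2.2

instance : DecidableRel Same := fun _ _ => Nat.decEq _ _

/-- The code of a monomial with natural exponents: the natural number with these exponents at the
primes `q j`. -/
noncomputable def godel (q : ℕ → ℕ) (u : ℕ →₀ ℕ) : ℕ := u.prod fun j k => q j ^ k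

theorem godel_add (q : ℕ → ℕ) (u v : ℕ →₀ ℕ) : godel q (u + v) = godel q u * godel q v :=
  Finsupp.prod_add_index' (by simp) fun _ _ _ => pow_add _ _ _

theorem godel_injective {q : ℕ → ℕ} (hq : ∀ j, (q j).Prime) (hinj : Function.Injective q) :
    Function.Injective (godel q) := by
  have key : ∀ u j, (godel q u).factorization (q j) = u j := by
    intro u j
    induction u using Finsupp.induction with
    | zero => simp [godel]
    | single_add i n u hi hn ih =>
      have h1 : godel q (Finsupp.single i n) = q i ^ n := by simp [godel]
      have h2 : godel q u ≠ 0 :=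
        Finset.prod_ne_zero_iff.2 fun k _ => pow_ne_zero _ (hq k).ne_zero
      rw [godel_add, Nat.factorization_mul (h1 ▸ pow_ne_zero _ (hq i).ne_zero) h2,
        Finsupp.add_apply, ih, h1, (hq i).factorization_pow, Finsupp.add_apply]
      congr 1
      by_cases h : i = j
      · subst h; simp
      · simp [h, hinj.ne h]
  intro u v h
  ext j
  rw [← key u, ← key v, h]

/-- `t` is a code of the term with exponent `m` and coefficient `a`. -/
def Codes (q : ℕ → ℕ) (t : Term) (m : ℕ →₀ ℤ) (a : ℤ) : Prop :=
  (∃ u v, t.2.2.1 = godel q u ∧ t.2.2.2 = godel q v ∧ m = natExp u - natExp v) ∧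
    a = (t.1 : ℤ) - t.2.1

variable {q : ℕ → ℕ} {s t : Term} {m n : ℕ →₀ ℤ} {a b : ℤ}

theorem Codes.mul (hs : Codes q s m a) (ht : Codes q t n b) :
    Codes q (s.mul t) (m + n) (a * b) := by
  obtain ⟨⟨u, v, hu, hv, rfl⟩, rfl⟩ := hs
  obtain ⟨⟨u', v', hu', hv', rfl⟩, rfl⟩ := ht
  refine ⟨⟨u + u', v + v', ?_, ?_, ?_⟩, ?_⟩
  · rw [godel_add, ← hu, ← hu']; rfl
  · rw [godel_add, ← hv, ← hv']; rfl
  · rw [map_add, map_add]; abel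
  · simp only [Term.mul]; push_cast; ring

theorem Codes.same_iff (hq : ∀ j, (q j).Prime) (hinj : Function.Injective q)
    (hs : Codes q s m a) (ht : Codes q t n b) : Same s t ↔ m = n := by
  obtain ⟨⟨u, v, hu, hv, rfl⟩, -⟩ := hs
  obtain ⟨⟨u', v', hu', hv', rfl⟩, -⟩ := ht
  rw [Same, hu, hv, hu', hv', ← godel_add, ← godel_add, (godel_injective hq hinj).eq_iff,
    sub_eq_sub_iff_add_eq_add, ← map_add, ← map_add, natExp_injective.eq_iff]

/-- The sum of the first components over the codes in `l` having the same monomial as `t`. -/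
def posPart (l : List Term) (t : Term) : ℕ :=
  l.foldr (fun s k => if Same s t then s.1 + k else k) 0

/-- The sum of the second components over the codes in `l` having the same monomial as `t`. -/
def negPart (l : List Term) (t : Term) : ℕ :=
  l.foldr (fun s k => if Same s t then s.2.1 + k else k) 0

/-- The sums of the terms coded by `l` and by `l'` are equal: the coefficients agree at every monomial
that occurs, with subtraction avoided. -/
def Equal (l l' : List Term) : Prop :=
  ∀ t ∈ l ++ l', posPart l t + negPart l' t = negPart l t + posPart l' t

end Term

end Laurent

section
open Laurent Laurent.Term

theorem primrec_same : PrimrecRel Term.Same := by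
  unfold Term.Same
  exact Primrec.eq.comp
    (Primrec.nat_mul.comp (Primrec.fst.comp (Primrec.snd.comp (Primrec.snd.comp Primrec.fst)))
      (Primrec.snd.comp (Primrec.snd.comp (Primrec.snd.comp Primrec.snd))))
    (Primrec.nat_mul.comp (Primrec.fst.comp (Primrec.snd.comp (Primrec.snd.comp Primrec.snd)))
      (Primrec.snd.comp (Primrec.snd.comp (Primrec.snd.comp Primrec.fst))))

theorem primrec_mul : Primrec₂ Term.mul := by
  unfold Term.mul
  have f1 : Primrec fun p : Term × Term => p.1.1 := Primrec.fst.comp Primrec.fst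
  have f2 : Primrec fun p : Term × Term => p.1.2.1 :=
    Primrec.fst.comp (Primrec.snd.comp Primrec.fst)
  have f3 : Primrec fun p : Term × Term => p.1.2.2.1 :=
    Primrec.fst.comp (Primrec.snd.comp (Primrec.snd.comp Primrec.fst))
  have f4 : Primrec fun p : Term × Term => p.1.2.2.2 :=
    Primrec.snd.comp (Primrec.snd.comp (Primrec.snd.comp Primrec.fst))
  have g1 : Primrec fun p : Term × Term => p.2.1 := Primrec.fst.comp Primrec.snd
  have g2 : Primrec fun p : Term × Term => p.2.2.1 :=
    Primrec.fst.comp (Primrec.snd.comp Primrec.snd)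
  have g3 : Primrec fun p : Term × Term => p.2.2.2.1 :=
    Primrec.fst.comp (Primrec.snd.comp (Primrec.snd.comp Primrec.snd))
  have g4 : Primrec fun p : Term × Term => p.2.2.2.2 :=
    Primrec.snd.comp (Primrec.snd.comp (Primrec.snd.comp Primrec.snd))
  exact (Primrec.nat_add.comp (Primrec.nat_mul.comp f1 g1) (Primrec.nat_mul.comp f2 g2)).pair
    ((Primrec.nat_add.comp (Primrec.nat_mul.comp f1 g2) (Primrec.nat_mul.comp f2 g1)).pair
      ((Primrec.nat_mul.comp f3 g3).pair (Primrec.nat_mul.comp f4 g4)))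

theorem primrec_posPart : Primrec₂ Term.posPart := by
  refine Primrec.list_foldr (h := fun (p : List Term × Term) (x : Term × ℕ) =>
    if Same x.1 p.2 then x.1.1 + x.2 else x.2) Primrec.fst (Primrec.const 0) ?_
  refine Primrec.ite (primrec_same.comp (Primrec.fst.comp Primrec.snd)
    (Primrec.snd.comp Primrec.fst)) ?_ (Primrec.snd.comp Primrec.snd)
  exact Primrec.nat_add.comp (Primrec.fst.comp (Primrec.fst.comp Primrec.snd))
    (Primrec.snd.comp Primrec.snd)

theorem primrec_negPart : Primrec₂ Term.negPart := by
  refine Primrec.list_foldr (h := fun (p : List Term × Term) (x : Term × ℕ) =>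
    if Same x.1 p.2 then x.1.2.1 + x.2 else x.2) Primrec.fst (Primrec.const 0) ?_
  refine Primrec.ite (primrec_same.comp (Primrec.fst.comp Primrec.snd)
    (Primrec.snd.comp Primrec.fst)) ?_ (Primrec.snd.comp Primrec.snd)
  exact Primrec.nat_add.comp (Primrec.fst.comp (Primrec.snd.comp (Primrec.fst.comp Primrec.snd)))
    (Primrec.snd.comp Primrec.snd)

theorem primrec_equal : PrimrecRel Term.Equal := by
  have h : PrimrecRel fun (t : Term) (x : List Term × List Term) =>
      posPart x.1 t + negPart x.2 t = negPart x.1 t + posPart x.2 t :=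
    Primrec.eq.comp
      (Primrec.nat_add.comp
        (primrec_posPart.comp (Primrec.fst.comp Primrec.snd) Primrec.fst)
        (primrec_negPart.comp (Primrec.snd.comp Primrec.snd) Primrec.fst))
      (Primrec.nat_add.comp
        (primrec_negPart.comp (Primrec.fst.comp Primrec.snd) Primrec.fst)
        (primrec_posPart.comp (Primrec.snd.comp Primrec.snd) Primrec.fst))
  exact h.forall_mem_list.comp (Primrec.list_append.comp Primrec.fst Primrec.snd) Primrec.id

end

namespace Laurent
open AddMonoidAlgebra

namespace Term

variable {q : ℕ → ℕ}

theorem coeff_sum_eq (hq : ∀ j, (q j).Prime) (hinj : Function.Injective q)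
    {ι : Type*} {τ : ι → Term} {μ : ι → ℕ →₀ ℤ} {α : ι → ℤ} (h : ∀ i, Codes q (τ i) (μ i) (α i))
    (l : List ι) (i : ι) :
    (l.map fun k => single (μ k) (α k)).sum.coeff (μ i) =
      (posPart (l.map τ) (τ i) : ℤ) - negPart (l.map τ) (τ i) := by
  classical
  induction l with
  | nil => simp [posPart, negPart]
  | cons k l ih =>
    have hs : Same (τ k) (τ i) ↔ μ k = μ i := (h k).same_iff hq hinj (h i)
    simp only [posPart, negPart] at ih
    simp only [List.map_cons, List.sum_cons, coeff_add, Finsupp.add_apply, ih, coeff_single,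
      Finsupp.single_apply, posPart, negPart, List.foldr_cons, ← hs, (h k).2]
    split_ifs
    · push_cast; ring
    · ring

theorem equal_iff (hq : ∀ j, (q j).Prime) (hinj : Function.Injective q)
    {ι : Type*} {τ : ι → Term} {μ : ι → ℕ →₀ ℤ} {α : ι → ℤ} (h : ∀ i, Codes q (τ i) (μ i) (α i))
    (l l' : List ι) :
    Equal (l.map τ) (l'.map τ) ↔
      (l.map fun k => (single (μ k) (α k) : Laurent)).sum =
        (l'.map fun k => single (μ k) (α k)).sum := by
  classical
  have hc : ∀ i, posPart (l.map τ) (τ i) + negPart (l'.map τ) (τ i) =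
      negPart (l.map τ) (τ i) + posPart (l'.map τ) (τ i) ↔
      (l.map fun k => (single (μ k) (α k) : Laurent)).sum.coeff (μ i) =
        (l'.map fun k => (single (μ k) (α k) : Laurent)).sum.coeff (μ i) := by
    intro i
    rw [coeff_sum_eq hq hinj h, coeff_sum_eq hq hinj h]
    omega
  have hz : ∀ (l : List ι) m, (∀ i ∈ l, μ i ≠ m) →
      (l.map fun k => (single (μ k) (α k) : Laurent)).sum.coeff m = 0 := by
    intro l m hl
    induction l with
    | nil => simp
    | cons k l ih =>
      rw [List.map_cons, List.sum_cons, coeff_add, Finsupp.add_apply,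
        ih fun i hi => hl i (List.mem_cons_of_mem _ hi), coeff_single,
        Finsupp.single_eq_of_ne (hl k List.mem_cons_self).symm, add_zero]
  constructor
  · intro he
    ext m
    by_cases hm : ∃ i ∈ l ++ l', μ i = m
    · obtain ⟨i, hi, rfl⟩ := hm
      refine (hc i).1 (he _ ?_)
      rw [← List.map_append]
      exact List.mem_map_of_mem hi
    · push Not at hm
      rw [hz l m fun i hi => hm i (List.mem_append_left _ hi),
        hz l' m fun i hi => hm i (List.mem_append_right _ hi)]
  · intro he t ht
    rw [← List.map_append] at ht
    obtain ⟨i, -, rfl⟩ := List.mem_map.1 ht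
    rw [hc, he]

end Term

/-- A subring generated by a computable sequence of terms that contains `-1` has a computable
presentation.  Codes of its elements are lists of lists of indices, standing for sums of products of
generators. -/
theorem exists_computableRing_closure {q : ℕ → ℕ} (hq : ∀ j, (q j).Prime)
    (hinj : Function.Injective q) {τ : ℕ → Term} (hτ : Primrec τ) {μ : ℕ → ℕ →₀ ℤ} {α : ℕ → ℤ}
    (h : ∀ k, Term.Codes q (τ k) (μ k) (α k)) (hneg : ∃ k, single (μ k) (α k) = (-1 : Laurent)) :
    ∃ A : ComputableRing, Nonempty (A.carrier ≃+*
      Subring.closure (Set.range fun k => (single (μ k) (α k) : Laurent))) := by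
  set γ : ℕ → Laurent := fun k => single (μ k) (α k)
  let wordTerm : List ℕ → Term := fun w => w.foldr (fun k t => (τ k).mul t) (1, 0, 1, 1)
  have hword : ∀ w : List ℕ, Term.Codes q (wordTerm w) (w.map μ).sum (w.map α).prod := by
    intro w
    induction w with
    | nil =>
      exact ⟨⟨0, 0, by simp [wordTerm, Term.godel], by simp [wordTerm, Term.godel], by simp⟩,
        by simp [wordTerm]⟩
    | cons k w ih => simpa [wordTerm] using (h k).mul ih
  have hprod : ∀ w : List ℕ, (w.map γ).prod = single (w.map μ).sum (w.map α).prod := by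
    intro w
    induction w with
    | nil => rfl
    | cons k w ih => simp [ih, γ, single_mul_single]
  let val' : List (List ℕ) → Laurent := fun l => (l.map fun w => (w.map γ).prod).sum
  have hmem : ∀ l, val' l ∈ Subring.closure (Set.range γ) := by
    intro l
    refine list_sum_mem fun x hx => ?_
    obtain ⟨w, -, rfl⟩ := List.mem_map.1 hx
    refine list_prod_mem fun y hy => ?_
    obtain ⟨k, -, rfl⟩ := List.mem_map.1 hy
    exact Subring.subset_closure ⟨k, rfl⟩
  refine ComputableRing.exists_of_codes (T := List (List ℕ)) (fun l => ⟨val' l, hmem l⟩) ?_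
    (fun l l' => l ++ l') (fun l l' => l.flatMap fun w => l'.map fun w' => w ++ w') ?_ ?_ ?_ ?_ ?_
  · rintro ⟨x, hx⟩
    obtain ⟨L, hL, rfl⟩ := Subring.exists_list_of_mem_closure hx
    have hlift : ∀ t ∈ L, ∃ w : List ℕ, (w.map γ) = t := by
      intro t ht
      have := hL t ht
      clear ht
      induction t with
      | nil => exact ⟨[], rfl⟩
      | cons y t ih =>
        obtain ⟨w, rfl⟩ := ih fun z hz => this z (List.mem_cons_of_mem _ hz)
        obtain ⟨k, rfl⟩ : ∃ k, γ k = y := by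
          rcases this y List.mem_cons_self with ⟨k, rfl⟩ | rfl
          exacts [⟨k, rfl⟩, hneg]
        exact ⟨k :: w, rfl⟩
    clear hL
    suffices ∃ l, val' l = (L.map List.prod).sum from this.imp fun l hl => Subtype.ext hl
    clear hx
    induction L with
    | nil => exact ⟨[], rfl⟩
    | cons t L ih =>
      obtain ⟨l, hl⟩ := ih fun t ht => hlift t (List.mem_cons_of_mem _ ht)
      obtain ⟨w, rfl⟩ := hlift t List.mem_cons_self
      exact ⟨w :: l, by simp [val', ← hl]⟩
  · intro l l'
    exact Subtype.ext (by simp [val'])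
  · intro l l'
    refine Subtype.ext ?_
    change val' _ = val' l * val' l'
    induction l with
    | nil => simp [val']
    | cons w l ih =>
      have hw : val' (l'.map fun w' => w ++ w') = (w.map γ).prod * val' l' := by
        simp only [val', List.map_map]
        rw [← List.sum_map_mul_left]
        simp [Function.comp_def]
      have happ : ∀ l₁ l₂, val' (l₁ ++ l₂) = val' l₁ + val' l₂ := fun l₁ l₂ => by simp [val']
      rw [List.flatMap_cons, happ, hw, ih, ← List.singleton_append (x := w), happ]
      simp [val', add_mul]
  · exact Primrec.list_append.to_comp
  · refine Primrec.to_comp (Primrec.list_flatMap Primrec.fst (Primrec.list_map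
      (Primrec.snd.comp Primrec.fst) ?_))
    exact Primrec.list_append.comp (Primrec.snd.comp Primrec.fst) Primrec.snd
  · have hwt : Primrec wordTerm :=
      Primrec.list_foldr (h := fun (_ : List ℕ) (x : ℕ × Term) => (τ x.1).mul x.2)
        Primrec.id (Primrec.const _) (primrec_mul.comp (hτ.comp (Primrec.fst.comp Primrec.snd))
          (Primrec.snd.comp Primrec.snd))
    have hmap : Primrec fun l : List (List ℕ) => l.map wordTerm :=
      Primrec.list_map Primrec.id (hwt.comp Primrec.snd)
    have : PrimrecPred fun t : List (List ℕ) × List (List ℕ) =>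
        Term.Equal (t.1.map wordTerm) (t.2.map wordTerm) :=
      primrec_equal.comp (hmap.comp Primrec.fst) (hmap.comp Primrec.snd)
    refine this.computablePred.of_eq fun t => ?_
    rw [Term.equal_iff hq hinj hword, Subtype.mk.injEq]
    simp only [val', hprod]

/-- The ring of elements of nonnegative weights has a computable presentation if the complement of
`D` is computably enumerable: `out j s` says that `j` has left `D` by stage `s`. -/
theorem exists_computableRing_weightRing {q : ℕ → ℕ} (hq : ∀ j, (q j).Prime)
    (hinj : Function.Injective q) (hqc : Primrec q) {r : ℕ → ℕ} (hr : Primrec r)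
    {out : ℕ → ℕ → Bool} (hout : Primrec₂ out) {D : Set ℕ}
    (hD : ∀ j, j ∈ D ↔ ∀ s, out j s = false) (hrD : Set.InjOn r D) :
    ∃ A : ComputableRing, Nonempty (A.carrier ≃+* weightRing D fun j => q (r j)) := by
  -- The index `⟨0, _⟩` gives `-1`, the index `⟨1, j, _⟩` gives `tⱼ`, and the other indices `⟨_, j, s⟩`
  -- give `tⱼ⁻¹` if `j` has left `D` by stage `s`, and `q (r j) · tⱼ⁻¹` otherwise.
  let jj : ℕ → ℕ := fun k => k.unpair.2.unpair.1
  let c : ℕ → ℕ := fun k => if out (jj k) k.unpair.2.unpair.2 then 1 else q (r (jj k))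
  let τ : ℕ → Term := fun k =>
    if k.unpair.1 = 0 then (0, 1, 1, 1)
    else if k.unpair.1 = 1 then (1, 0, q (jj k), 1) else (c k, 0, 1, q (jj k))
  let μ : ℕ → ℕ →₀ ℤ := fun k =>
    if k.unpair.1 = 0 then 0
    else if k.unpair.1 = 1 then Finsupp.single (jj k) 1 else -Finsupp.single (jj k) 1
  let α : ℕ → ℤ := fun k =>
    if k.unpair.1 = 0 then -1 else if k.unpair.1 = 1 then 1 else c k
  have hjj : Primrec jj := Primrec.fst.comp (Primrec.unpair.comp (Primrec.snd.comp Primrec.unpair))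
  have hkind : Primrec fun k : ℕ => k.unpair.1 := Primrec.fst.comp Primrec.unpair
  have hc : Primrec c := by
    refine Primrec.ite ?_ (Primrec.const 1) (hqc.comp (hr.comp hjj))
    exact Primrec.eq.comp (hout.comp hjj
      (Primrec.snd.comp (Primrec.unpair.comp (Primrec.snd.comp Primrec.unpair))))
      (Primrec.const true)
  have hτ : Primrec τ := by
    refine Primrec.ite (Primrec.eq.comp hkind (Primrec.const 0)) (Primrec.const _)
      (Primrec.ite (Primrec.eq.comp hkind (Primrec.const 1)) ?_ ?_)
    · exact (Primrec.const 1).pair ((Primrec.const 0).pair ((hqc.comp hjj).pair (Primrec.const 1)))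
    · exact hc.pair ((Primrec.const 0).pair ((Primrec.const 1).pair (hqc.comp hjj)))
  have hsingle : ∀ j, natExp (Finsupp.single j 1) = Finsupp.single j 1 := fun j => by
    simp [natExp]
  have hgodel : ∀ j, Term.godel q (Finsupp.single j 1) = q j := fun j => by simp [Term.godel]
  have hgodel0 : Term.godel q 0 = 1 := by simp [Term.godel]
  have hcodes : ∀ k, Term.Codes q (τ k) (μ k) (α k) := by
    intro k
    simp only [τ, μ, α]
    split_ifs
    · exact ⟨⟨0, 0, hgodel0.symm, hgodel0.symm, by simp⟩, by simp⟩
    · exact ⟨⟨Finsupp.single (jj k) 1, 0, (hgodel _).symm, hgodel0.symm, by simp [hsingle]⟩,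
        by simp⟩
    · exact ⟨⟨0, Finsupp.single (jj k) 1, hgodel0.symm, (hgodel _).symm, by simp [hsingle]⟩,
        by simp⟩
  have hneg : (single (μ 0) (α 0) : Laurent) = -1 := by
    simp [μ, α, one_def, ← single_neg]
  have hcl : Subring.closure (Set.range fun k => (single (μ k) (α k) : Laurent)) =
      weightRing D fun j => q (r j) := by
    rw [← closure_weightGens (fun j => hq (r j)) (hinj.injOn.comp hrD fun _ _ => Set.mem_univ _)]
    refine le_antisymm (Subring.closure_le.2 ?_) (Subring.closure_le.2 ?_)
    · rintro _ ⟨k, rfl⟩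
      simp only [μ, α]
      split_ifs
      · rw [single_neg]
        exact neg_mem (one_mem _)
      · exact Subring.subset_closure ⟨jj k, .inl rfl⟩
      · by_cases ho : out (jj k) k.unpair.2.unpair.2
        · refine Subring.subset_closure ⟨jj k, .inr (.inr ⟨fun h => ?_, ?_⟩)⟩
          · simp [(hD _).1 h] at ho
          · simp [c, ho]
        · refine Subring.subset_closure ⟨jj k, .inr (.inl ?_)⟩
          simp [c, ho]
    · have hk : ∀ j s, single (-Finsupp.single j 1) (if out j s then 1 else (q (r j) : ℤ)) ∈
          Subring.closure (Set.range fun k => (single (μ k) (α k) : Laurent)) := by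
        intro j s
        refine Subring.subset_closure ⟨Nat.pair 2 (Nat.pair j s), ?_⟩
        simp [μ, α, c, jj]
      rintro _ ⟨j, rfl | rfl | ⟨hj, rfl⟩⟩
      · refine Subring.subset_closure ⟨Nat.pair 1 (Nat.pair j 0), ?_⟩
        simp [μ, α, jj]
      · -- if `tⱼ⁻¹` is what the generator at stage 0 gives, then `q (r j) · tⱼ⁻¹` is a multiple of it
        have := hk j 0
        by_cases ho : out j 0
        · rw [if_pos ho] at this
          have h2 := mul_mem (natCast_mem
            (Subring.closure (Set.range fun k => (single (μ k) (α k) : Laurent))) (q (r j))) this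
          rwa [natCast_def, single_mul_single, zero_add, mul_one] at h2
        · rwa [if_neg ho] at this
      · rw [hD] at hj
        push Not at hj
        obtain ⟨s, hs⟩ := hj
        simpa [hs] using hk j s
  obtain ⟨A, ⟨e⟩⟩ := exists_computableRing_closure hq hinj hτ hcodes ⟨0, hneg⟩
  exact ⟨A, ⟨e.trans (RingEquiv.subringCongr hcl)⟩⟩

end Laurent

/-! ### A primitive recursive sequence of primes -/

/-- Bounded universal quantification with parameters of any type. -/
theorem PrimrecRel.forall_lt_right {α : Type*} [Primcodable α] {R : ℕ → α → Prop}
    (h : PrimrecRel R) : PrimrecRel fun (n : ℕ) a => ∀ x < n, R x a :=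
  (h.forall_mem_list.comp (Primrec.list_range.comp Primrec.fst) Primrec.snd).of_eq (by simp)

theorem primrecPred_prime : PrimrecPred Nat.Prime := by
  have h1 : PrimrecRel fun b (x : ℕ × ℕ) => x.1 * b ≠ x.2 :=
    PrimrecPred.not (Primrec.eq.comp (Primrec.nat_mul.comp (Primrec.fst.comp Primrec.snd) Primrec.fst)
      (Primrec.snd.comp Primrec.snd))
  have h1' := h1.forall_lt_right
  have h2 : PrimrecRel fun a n => ∀ b < n, a * b ≠ n :=
    h1'.comp (f := fun x : ℕ × ℕ => x.2) (g := fun x => x) Primrec.snd Primrec.id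
  have h3 : PrimrecPred fun n : ℕ => 2 ≤ n ∧ ∀ a < n, ∀ b < n, a * b ≠ n :=
    (Primrec.nat_le.comp (Primrec.const 2) Primrec.id).and (h2.forall_lt_right.comp Primrec.id Primrec.id)
  refine h3.of_eq fun n => ?_
  rw [Nat.prime_def, and_congr_right_iff]
  intro hn
  constructor
  · rintro h m ⟨k, rfl⟩
    by_contra! hm
    obtain ⟨h1, h2⟩ := hm
    have hm0 : 0 < m := by by_contra h0; simp [show m = 0 by omega] at hn
    have hk0 : 0 < k := by by_contra h0; simp [show k = 0 by omega] at hn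
    have hk1 : k ≠ 1 := by rintro rfl; simp at h2
    refine h m ?_ k ?_ rfl
    · exact (Nat.lt_mul_iff_one_lt_right hm0).2 (by omega)
    · exact (Nat.lt_mul_iff_one_lt_left hk0).2 (by omega)
  · intro h a ha b hb hab
    rcases h a ⟨b, hab.symm⟩ with h1 | h1
    · subst h1; omega
    · omega

/-- A strictly increasing sequence of primes.  A bound for the search of the next prime makes the
sequence primitive recursive; it is immaterial which prime below the bound is taken. -/
def primeSeq : ℕ → ℕ
  | 0 => 2
  | n + 1 => Nat.findGreatest (fun p => p.Prime ∧ primeSeq n < p) ((primeSeq n).factorial + 1)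

theorem primeSeq_succ (n : ℕ) : (primeSeq (n + 1)).Prime ∧ primeSeq n < primeSeq (n + 1) := by
  rw [primeSeq]
  have hne : (primeSeq n).factorial + 1 ≠ 1 := by have := (primeSeq n).factorial_pos; omega
  refine Nat.findGreatest_spec (P := fun p => p.Prime ∧ primeSeq n < p)
    (Nat.minFac_le (n := (primeSeq n).factorial + 1) (by omega)) ⟨Nat.minFac_prime hne, ?_⟩
  by_contra! hle
  have h1 := Nat.dvd_factorial (Nat.minFac_pos _) hle
  exact (Nat.minFac_prime hne).one_lt.ne'
    (Nat.dvd_one.1 ((Nat.dvd_add_right h1).1 (Nat.minFac_dvd _)))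

theorem prime_primeSeq (n : ℕ) : (primeSeq n).Prime := by
  cases n with
  | zero => exact Nat.prime_two
  | succ n => exact (primeSeq_succ n).1

theorem primeSeq_injective : Function.Injective primeSeq :=
  (strictMono_nat_of_lt_succ fun n => (primeSeq_succ n).2).injective

theorem primrec_primeSeq : Primrec primeSeq := by
  have hfac : Primrec Nat.factorial := by
    refine (Primrec.nat_rec₁ 1 (f := fun n k => (n + 1) * k) ?_).of_eq fun n => ?_
    · exact Primrec.nat_mul.comp (Primrec.succ.comp Primrec.fst) Primrec.snd
    · induction n with
      | zero => rfl
      | succ n ih => rw [Nat.factorial_succ, ← ih]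
  refine (Primrec.nat_rec₁ 2 (f := fun _ k =>
    Nat.findGreatest (fun p => p.Prime ∧ k < p) (k.factorial + 1)) ?_).of_eq fun n => ?_
  · refine Primrec.nat_findGreatest (f := fun x : ℕ × ℕ => x.2.factorial + 1)
      (p := fun x p => p.Prime ∧ x.2 < p) (Primrec.succ.comp (hfac.comp Primrec.snd)) ?_
    exact (primrecPred_prime.comp Primrec.snd).and
      (Primrec.nat_lt.comp (Primrec.snd.comp Primrec.fst) Primrec.snd)
  · induction n with
    | zero => rfl
    | succ n ih => rw [primeSeq, ← ih]

/-! ### The universal `Π⁰₂` set and its least counterexamples -/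

open Nat.Partrec (Code)

/-- For `i = ⟨c, z⟩`: the program with code `c` halts on the input `⟨x, z⟩` within `k` steps. -/
def haltsBy (i x k : ℕ) : Bool :=
  (Code.evaln k (Denumerable.ofNat Code i.unpair.1) (Nat.pair x i.unpair.2)).isSome

theorem haltsBy_mono {i x k l : ℕ} (hkl : k ≤ l) (h : haltsBy i x k) : haltsBy i x l := by
  rw [haltsBy, Option.isSome_iff_exists] at *
  exact h.imp fun y hy => Code.evaln_mono hkl hy

theorem exists_haltsBy (i x : ℕ) :
    (∃ k, haltsBy i x k) ↔
      ((Denumerable.ofNat Code i.unpair.1).eval (Nat.pair x i.unpair.2)).Dom := by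
  simp only [haltsBy, Option.isSome_iff_exists, Part.dom_iff_mem]
  rw [exists_comm]
  exact exists_congr fun y => Code.evaln_complete.symm

/-- The universal `Π⁰₂` set: the pairs `⟨c, z⟩` such that the program with code `c` halts on all
inputs `⟨x, z⟩`. -/
def universalPi2 : Set ℕ := {i | ∀ x, ∃ k, haltsBy i x k}

/-- `b` is the least number of steps within which the computations at all `y < x` have halted. -/
def IsModulus (i x b : ℕ) : Prop :=
  (∀ y < x, haltsBy i y b) ∧ ∀ c < b, ¬ ∀ y < x, haltsBy i y c

theorem primrec_haltsBy : Primrec fun t : ℕ × ℕ × ℕ => haltsBy t.1 t.2.1 t.2.2 := by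
  refine Primrec.option_isSome.comp (Code.primrec_evaln.comp
    (((Primrec.snd.comp Primrec.snd).pair ((Primrec.ofNat Code).comp
      (Primrec.fst.comp (Primrec.unpair.comp Primrec.fst)))).pair ?_))
  exact Primrec₂.natPair.comp (Primrec.fst.comp Primrec.snd)
    (Primrec.snd.comp (Primrec.unpair.comp Primrec.fst))

theorem primrecPred_isModulus :
    PrimrecPred fun t : ℕ × ℕ × ℕ => IsModulus t.1 t.2.1 t.2.2 := by
  have h1 : PrimrecRel fun (y : ℕ) (t : ℕ × ℕ) => haltsBy t.1 y t.2 := by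
    have h0 : Primrec fun x : ℕ × ℕ × ℕ => (x.2.1, x.1, x.2.2) :=
      (Primrec.fst.comp Primrec.snd).pair (Primrec.fst.pair (Primrec.snd.comp Primrec.snd))
    exact Primrec.eq.comp (primrec_haltsBy.comp h0) (Primrec.const true)
  have h1' := h1.forall_lt_right
  have h2 : PrimrecRel fun (c : ℕ) (t : ℕ × ℕ) => ∀ y < t.2, haltsBy t.1 y c :=
    h1'.comp (f := fun x : ℕ × ℕ × ℕ => x.2.2) (g := fun x => (x.2.1, x.1))
      (Primrec.snd.comp Primrec.snd) ((Primrec.fst.comp Primrec.snd).pair Primrec.fst)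
  have h3 := h2.not.forall_lt_right
  have p : Primrec fun t : ℕ × ℕ × ℕ => (t.1, t.2.1) :=
    Primrec.fst.pair (Primrec.fst.comp Primrec.snd)
  have b : Primrec fun t : ℕ × ℕ × ℕ => t.2.2 := Primrec.snd.comp Primrec.snd
  exact PrimrecPred.and (h2.comp b p) (h3.comp b p)

theorem exists_isModulus {i x : ℕ} (h : ∀ y < x, ∃ k, haltsBy i y k) : ∃ b, IsModulus i x b := by
  classical
  have hex : ∃ b, ∀ y < x, haltsBy i y b := by
    induction x with
    | zero => exact ⟨0, by simp⟩
    | succ x ih =>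
      obtain ⟨b, hb⟩ := ih fun y hy => h y (by omega)
      obtain ⟨k, hk⟩ := h x (by omega)
      refine ⟨max b k, fun y hy => ?_⟩
      rcases Nat.lt_succ_iff_lt_or_eq.1 hy with hy | rfl
      · exact haltsBy_mono (le_max_left _ _) (hb y hy)
      · exact haltsBy_mono (le_max_right _ _) hk
  exact ⟨Nat.find hex, Nat.find_spec hex, fun c hc => Nat.find_min hex hc⟩

theorem IsModulus.unique {i x b c : ℕ} (hb : IsModulus i x b) (hc : IsModulus i x c) : b = c := by
  rcases lt_trichotomy b c with h | h | h
  · exact absurd hb.1 (hc.2 b h)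
  · exact h
  · exact absurd hc.1 (hb.2 c h)

/-- The triples `⟨i, x, b⟩` such that `x` is the least input at which `i` fails to belong to the
universal set, and `b` is the number of steps needed for all smaller inputs.  Including `b` makes the
minimality of `x` decidable, so that the complement is computably enumerable. -/
def failures : Set ℕ := {j | IsModulus j.unpair.1 j.unpair.2.unpair.1 j.unpair.2.unpair.2 ∧
  ∀ k, ¬ haltsBy j.unpair.1 j.unpair.2.unpair.1 k}

theorem injOn_failures : Set.InjOn (fun j : ℕ => j.unpair.1) failures := by
  rintro j ⟨hj, hj'⟩ k ⟨hk, hk'⟩ (h : j.unpair.1 = k.unpair.1)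
  rw [h] at hj hj'
  have hx : j.unpair.2.unpair.1 = k.unpair.2.unpair.1 := by
    rcases lt_trichotomy j.unpair.2.unpair.1 k.unpair.2.unpair.1 with hlt | heq | hlt
    · exact absurd (hk.1 _ hlt) (hj' _)
    · exact heq
    · exact absurd (hj.1 _ hlt) (hk' _)
  rw [hx] at hj
  have hb := hj.unique hk
  rw [← Nat.pair_unpair j, ← Nat.pair_unpair k, h, ← Nat.pair_unpair j.unpair.2, hx, hb,
    Nat.pair_unpair k.unpair.2]

theorem exists_failures_iff (i : ℕ) : (∃ j ∈ failures, j.unpair.1 = i) ↔ i ∉ universalPi2 := by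
  classical
  constructor
  · rintro ⟨j, hj, rfl⟩ h
    obtain ⟨k, hk⟩ := h j.unpair.2.unpair.1
    exact hj.2 k hk
  · intro h
    have hex : ∃ x, ∀ k, ¬ haltsBy i x k := by simpa [universalPi2] using h
    obtain ⟨b, hb⟩ := exists_isModulus (i := i) (x := Nat.find hex) fun y hy => by
      simpa using Nat.find_min hex hy
    refine ⟨Nat.pair i (Nat.pair (Nat.find hex) b), ?_, by simp⟩
    simp only [failures, Set.mem_ofPred_eq, Nat.unpair_pair]
    exact ⟨hb, Nat.find_spec hex⟩

open Classical in
/-- By stage `s` it has become visible that `j` does not belong to `failures`. -/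
noncomputable def seenOut (j s : ℕ) : Bool :=
  decide (¬ IsModulus j.unpair.1 j.unpair.2.unpair.1 j.unpair.2.unpair.2 ∨
    haltsBy j.unpair.1 j.unpair.2.unpair.1 s)

theorem mem_failures_iff (j : ℕ) : j ∈ failures ↔ ∀ s, seenOut j s = false := by
  simp [failures, seenOut, forall_and]

theorem primrec_seenOut : Primrec₂ seenOut := by
  classical
  have hj : Primrec fun t : ℕ × ℕ => t.1.unpair.1 :=
    Primrec.fst.comp (Primrec.unpair.comp Primrec.fst)
  have hr : Primrec fun t : ℕ × ℕ => t.1.unpair.2.unpair :=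
    Primrec.unpair.comp (Primrec.snd.comp (Primrec.unpair.comp Primrec.fst))
  have h1 := (primrecPred_isModulus.comp (hj.pair hr)).not
  have h2 : PrimrecPred fun t : ℕ × ℕ => haltsBy t.1.unpair.1 t.1.unpair.2.unpair.1 t.2 :=
    Primrec.eq.comp (primrec_haltsBy.comp (hj.pair ((Primrec.fst.comp hr).pair Primrec.snd)))
      (Primrec.const true)
  exact (h1.or h2).decide

/-- The universal set is universal: every `Π⁰₂` set is one of its sections. -/
theorem exists_index_universalPi2 {Z : Set ℕ} (hZ : IsPi2 Z) :
    ∃ c, ∀ i, i ∈ Z ↔ Nat.pair c i ∈ universalPi2 := by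
  classical
  obtain ⟨R, hR, hZ⟩ := hZ
  have hR := hR.decide
  let G : ℕ × ℕ → Bool := fun x => decide (R x.1.unpair.1 x.2 x.1.unpair.2)
  have hG : Computable G := by
    have h0 : Computable fun x : ℕ × ℕ => (x.1.unpair.1, x.2, x.1.unpair.2) :=
      (Computable.fst.comp (Computable.unpair.comp Computable.fst)).pair
        (Computable.snd.pair (Computable.snd.comp (Computable.unpair.comp Computable.fst)))
    exact (Computable.comp hR h0).of_eq fun x => decide_eq_decide.2 Iff.rfl
  let P : ℕ → ℕ →. Bool := fun n y => Part.some (G (n, y))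
  have hF : Partrec fun n => Nat.rfind (P n) := Partrec.rfind (p := P) hG.partrec
  obtain ⟨c, hc⟩ := Code.exists_code.1 (Partrec.nat_iff.1 hF)
  have key : ∀ x i, (c.eval (Nat.pair x i)).Dom ↔ ∃ y, R x y i := by
    intro x i
    rw [hc]
    refine Nat.rfind_dom.trans (exists_congr fun y => ?_)
    simp [P, G]
  refine ⟨Encodable.encode c, fun i => ?_⟩
  rw [hZ]
  refine forall_congr' fun x => ?_
  rw [exists_haltsBy, Nat.unpair_pair, ← key, Denumerable.ofNat_encode]

/-! ### `Σ⁰₁` predicates -/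

/-- A `Σ⁰₁` predicate, in the form of an unbounded existential quantifier over a computable relation.
Unlike for `REPred`, the relation is at hand. -/
def IsSigma1 {α : Type*} [Primcodable α] (p : α → Prop) : Prop :=
  ∃ R : α → ℕ → Bool, Computable₂ R ∧ ∀ a, p a ↔ ∃ y, R a y

namespace IsSigma1

variable {α β : Type*} [Primcodable α] [Primcodable β] {p q : α → Prop}

theorem of_computable {f : α → Bool} (hf : Computable f) : IsSigma1 fun a => f a :=
  ⟨fun a _ => f a, hf.comp Computable.fst, fun a => by simp⟩

theorem comp {f : β → α} (hp : IsSigma1 p) (hf : Computable f) : IsSigma1 fun b => p (f b) := by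
  obtain ⟨R, hR, h⟩ := hp
  exact ⟨fun b y => R (f b) y, hR.comp (hf.comp Computable.fst) Computable.snd, fun b => h (f b)⟩

theorem or (hp : IsSigma1 p) (hq : IsSigma1 q) : IsSigma1 fun a => p a ∨ q a := by
  obtain ⟨R, hR, h⟩ := hp
  obtain ⟨S, hS, h'⟩ := hq
  refine ⟨fun a y => R a y || S a y, Primrec.or.to_comp.comp hR hS, fun a => ?_⟩
  simp only [h, h', ← exists_or, Bool.or_eq_true]

theorem and (hp : IsSigma1 p) (hq : IsSigma1 q) : IsSigma1 fun a => p a ∧ q a := by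
  obtain ⟨R, hR, h⟩ := hp
  obtain ⟨S, hS, h'⟩ := hq
  have hu : Computable fun t : α × ℕ => t.2.unpair := Computable.unpair.comp Computable.snd
  refine ⟨fun a y => R a y.unpair.1 && S a y.unpair.2, Primrec.and.to_comp.comp
    (hR.comp Computable.fst (Computable.fst.comp hu))
    (hS.comp Computable.fst (Computable.snd.comp hu)), fun a => ?_⟩
  simp only [h, h']
  constructor
  · rintro ⟨⟨y, hy⟩, z, hz⟩
    exact ⟨Nat.pair y z, by simp [hy, hz]⟩
  · rintro ⟨y, hy⟩
    rw [Bool.and_eq_true] at hy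
    exact ⟨⟨_, hy.1⟩, _, hy.2⟩

theorem ex {p : α → ℕ → Prop} (hp : IsSigma1 fun t : α × ℕ => p t.1 t.2) :
    IsSigma1 fun a => ∃ x, p a x := by
  obtain ⟨R, hR, h⟩ := hp
  have hu : Computable fun t : α × ℕ => t.2.unpair := Computable.unpair.comp Computable.snd
  refine ⟨fun a y => R (a, y.unpair.1) y.unpair.2, hR.comp
    (Computable.fst.pair (Computable.fst.comp hu)) (Computable.snd.comp hu), fun a => ?_⟩
  constructor
  · rintro ⟨x, hx⟩
    obtain ⟨y, hy⟩ := (h (a, x)).1 hx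
    exact ⟨Nat.pair x y, by simpa using hy⟩
  · rintro ⟨y, hy⟩
    exact ⟨_, (h (a, _)).2 ⟨_, hy⟩⟩

theorem ne {f g : α → ℕ} (hf : Computable f) (hg : Computable g) : IsSigma1 fun a => f a ≠ g a := by
  obtain ⟨R, hR, h⟩ :=
    of_computable (Primrec.not.to_comp.comp (Primrec.eq.decide.to_comp.comp hf hg))
  exact ⟨R, hR, fun a => by rw [← h]; simp⟩

theorem mem_eval {c : α → Code} {x v : α → ℕ} (hc : Computable c) (hx : Computable x)
    (hv : Computable v) : IsSigma1 fun a => v a ∈ (c a).eval (x a) := by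
  refine ⟨fun a k => decide (Code.evaln k (c a) (x a) = some (v a)), ?_, fun a => ?_⟩
  · refine Primrec.eq.decide.to_comp.comp (Code.primrec_evaln.to_comp.comp
      ((Computable.snd.pair (hc.comp Computable.fst)).pair (hx.comp Computable.fst)))
      (Computable.option_some.comp (hv.comp Computable.fst))
  · simp [Code.evaln_complete]

/-- A witness for a `Σ⁰₁` relation can be computed whenever there is one. -/
theorem exists_choice {p : α → ℕ → Prop} (hp : IsSigma1 fun t : α × ℕ => p t.1 t.2) :
    ∃ F : α →. ℕ, Partrec F ∧ ∀ a, (∃ v, p a v) → ∃ v, F a = Part.some v ∧ p a v := by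
  obtain ⟨R, hR, h⟩ := hp
  let P : α → ℕ →. Bool := fun a y => Part.some (R (a, y.unpair.1) y.unpair.2)
  have hu : Computable fun t : α × ℕ => t.2.unpair := Computable.unpair.comp Computable.snd
  have hP : Partrec₂ P := Computable.partrec
    (hR.comp (Computable.fst.pair (Computable.fst.comp hu)) (Computable.snd.comp hu))
  refine ⟨fun a => (Nat.rfind (P a)).map fun y => y.unpair.1, (Partrec.rfind hP).map
    (g := fun (_ : α) (y : ℕ) => y.unpair.1)
    (Computable.fst.comp (Computable.unpair.comp Computable.snd)), ?_⟩
  rintro a ⟨v, hv⟩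
  obtain ⟨w, hw⟩ := (h (a, v)).1 hv
  have hdom : (Nat.rfind (P a)).Dom :=
    Nat.rfind_dom.2 ⟨Nat.pair v w, by simpa [P] using hw.symm, fun _ => trivial⟩
  obtain ⟨y, hy⟩ := Part.dom_iff_mem.1 hdom
  refine ⟨y.unpair.1, ?_, (h (a, _)).2 ⟨y.unpair.2, ?_⟩⟩
  · change (Nat.rfind (P a)).map _ = _
    rw [Part.eq_some_iff.2 hy, Part.map_some]
  · have hy' := Nat.rfind_spec hy
    simpa [P] using hy'

end IsSigma1

/-! ### Primes of computable unique factorization domains -/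

namespace ComputableRing

variable {B : ComputableRing} {e : Index}

namespace IsIndex

theorem one_mem_iff (h : B.IsIndex e) (n : ℕ) : 1 ∈ e.1.eval n ↔ n ∈ B.carrier := by
  rw [h.carrier, Part.mem_some_iff]
  split_ifs with hn <;> simp [hn]

theorem zero_mem_iff (h : B.IsIndex e) (n : ℕ) : 0 ∈ e.1.eval n ↔ n ∉ B.carrier := by
  rw [h.carrier, Part.mem_some_iff]
  split_ifs with hn <;> simp [hn]

theorem mem_add_iff (h : B.IsIndex e) (a b : B.carrier) (r : ℕ) :
    r ∈ e.2.1.eval (Nat.pair a b) ↔ r = (a + b : B.carrier) := by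
  rw [h.add, Part.mem_some_iff]

theorem mem_mul_iff (h : B.IsIndex e) (a b : B.carrier) (r : ℕ) :
    r ∈ e.2.2.eval (Nat.pair a b) ↔ r = (a * b : B.carrier) := by
  rw [h.mul, Part.mem_some_iff]

end IsIndex

/-- In terms of an index: `n + n ≠ n`, that is, `n ≠ 0`. -/
def AddNe (e : Index) (n : ℕ) : Prop := ∃ z, z ∈ e.2.1.eval (Nat.pair n n) ∧ z ≠ n

/-- In terms of an index: `a * c * a = a` for some element `c`.  In a domain, and if `a ≠ 0`, this says
that `a` is a unit, and it does so without mentioning 1. -/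
def HasQuasiInv (e : Index) (a : ℕ) : Prop :=
  ∃ c, 1 ∈ e.1.eval c ∧ ∃ r, r ∈ e.2.2.eval (Nat.pair a c) ∧ a ∈ e.2.2.eval (Nat.pair r a)

/-- In terms of an index: `n * a * n ≠ n`; in a domain, and if `n ≠ 0`, this says that `a` is not
inverse to `n`. -/
def MulMulNe (e : Index) (n a : ℕ) : Prop :=
  ∃ r, r ∈ e.2.2.eval (Nat.pair n a) ∧ ∃ s, s ∈ e.2.2.eval (Nat.pair r n) ∧ s ≠ n

/-- In terms of an index: `a * b ≠ n`. -/
def MulNe (e : Index) (n a b : ℕ) : Prop := ∃ r, r ∈ e.2.2.eval (Nat.pair a b) ∧ r ≠ n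

/-- In terms of an index: `n` is a nonzero element, and if `a` and `b` are elements, then `a` is not
inverse to `n` and `n = a * b` only if `a` or `b` is a unit.  This holds for all `a` and `b` iff `n`
is irreducible. -/
def IrreducibleAt (e : Index) (n a b : ℕ) : Prop :=
  1 ∈ e.1.eval n ∧ AddNe e n ∧ (0 ∈ e.1.eval a ∨ 0 ∈ e.1.eval b ∨
    (MulMulNe e n a ∧ (MulNe e n a b ∨ HasQuasiInv e a ∨ HasQuasiInv e b)))

section Sigma

variable {α : Type*} [Primcodable α] {i : α → Index} {n a b : α → ℕ}
  (hi : Computable i) (hn : Computable n) (ha : Computable a) (hb : Computable b)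

include hi hn in
theorem isSigma1_mem_char (k : ℕ) : IsSigma1 fun x => k ∈ (i x).1.eval (n x) :=
  .mem_eval (Computable.fst.comp hi) hn (Computable.const k)

include hi hn ha hb in
theorem isSigma1_mem_mul : IsSigma1 fun x => n x ∈ (i x).2.2.eval (Nat.pair (a x) (b x)) :=
  .mem_eval (Computable.snd.comp (Computable.snd.comp hi)) (Primrec₂.natPair.to_comp.comp ha hb) hn

include hi hn ha hb in
theorem isSigma1_mem_add : IsSigma1 fun x => n x ∈ (i x).2.1.eval (Nat.pair (a x) (b x)) :=
  .mem_eval (Computable.fst.comp (Computable.snd.comp hi)) (Primrec₂.natPair.to_comp.comp ha hb) hn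

include hi hn in
theorem isSigma1_addNe : IsSigma1 fun x => AddNe (i x) (n x) := by
  have hn' := hn.comp (Computable.fst (α := α) (β := ℕ))
  exact .ex (.and (isSigma1_mem_add (hi.comp Computable.fst) Computable.snd hn' hn')
    (.ne Computable.snd hn'))

include hi hn ha hb in
theorem isSigma1_mulNe : IsSigma1 fun x => MulNe (i x) (n x) (a x) (b x) :=
  .ex (.and (isSigma1_mem_mul (hi.comp Computable.fst) Computable.snd (ha.comp Computable.fst)
    (hb.comp Computable.fst)) (.ne Computable.snd (hn.comp Computable.fst)))

include hi hn ha in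
theorem isSigma1_mulMulNe : IsSigma1 fun x => MulMulNe (i x) (n x) (a x) := by
  have hi' := hi.comp (Computable.fst (α := α) (β := ℕ))
  have hn' := hn.comp (Computable.fst (α := α) (β := ℕ))
  exact .ex (.and (isSigma1_mem_mul hi' Computable.snd hn' (ha.comp Computable.fst))
    (isSigma1_mulNe hi' hn' Computable.snd hn'))

include hi ha in
theorem isSigma1_hasQuasiInv : IsSigma1 fun x => HasQuasiInv (i x) (a x) := by
  have hi' := hi.comp (Computable.fst (α := α) (β := ℕ))
  have ha' := ha.comp (Computable.fst (α := α) (β := ℕ))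
  have hi'' := hi'.comp (Computable.fst (α := α × ℕ) (β := ℕ))
  have ha'' := ha'.comp (Computable.fst (α := α × ℕ) (β := ℕ))
  exact .ex (.and (isSigma1_mem_char hi' Computable.snd 1) (.ex (.and
    (isSigma1_mem_mul hi'' Computable.snd ha'' (Computable.snd.comp Computable.fst))
    (isSigma1_mem_mul hi'' ha'' Computable.snd ha''))))

include hi hn ha hb in
theorem isSigma1_irreducibleAt : IsSigma1 fun x => IrreducibleAt (i x) (n x) (a x) (b x) :=
  .and (isSigma1_mem_char hi hn 1) (.and (isSigma1_addNe hi hn)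
    (.or (isSigma1_mem_char hi ha 0) (.or (isSigma1_mem_char hi hb 0)
      (.and (isSigma1_mulMulNe hi hn ha) (.or (isSigma1_mulNe hi hn ha hb)
        (.or (isSigma1_hasQuasiInv hi ha) (isSigma1_hasQuasiInv hi hb)))))))

end Sigma

theorem exists_isIndex (B : ComputableRing) : ∃ e : Index, B.IsIndex e := by
  classical
  have hch : Computable fun n : ℕ => if n ∈ B.carrier then 1 else 0 := by
    refine (Computable.cond B.computable_carrier.decide (Computable.const 1)
      (Computable.const 0)).of_eq fun n => ?_
    by_cases h : n ∈ B.carrier <;> simp [h]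
  obtain ⟨c, hc⟩ := Code.exists_code.1 (Partrec.nat_iff.1 hch.partrec)
  have hbin : ∀ f : ℕ → ℕ → ℕ, Computable₂ f →
      ∃ c : Code, ∀ a b, c.eval (Nat.pair a b) = Part.some (f a b) := by
    intro f hf
    have hf' : Computable fun n : ℕ => f n.unpair.1 n.unpair.2 :=
      hf.comp (Computable.fst.comp Computable.unpair) (Computable.snd.comp Computable.unpair)
    obtain ⟨c, hc⟩ := Code.exists_code.1 (Partrec.nat_iff.1 hf'.partrec)
    exact ⟨c, fun a b => by rw [hc]; simp⟩
  obtain ⟨f, hf, hf'⟩ := B.computable_add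
  obtain ⟨g, hg, hg'⟩ := B.computable_mul
  obtain ⟨ca, hca⟩ := hbin f hf
  obtain ⟨cm, hcm⟩ := hbin g hg
  refine ⟨(c, ca, cm), ⟨fun n => ?_, fun a b => ?_, fun a b => ?_⟩⟩
  · rw [hc]
    simp only [PFun.coe_val]
  · rw [hca, hf']
  · rw [hcm, hg']

theorem mulNe_iff (h : B.IsIndex e) (n a b : B.carrier) : MulNe e n a b ↔ a * b ≠ n := by
  simp [MulNe, h.mem_mul_iff, Subtype.coe_inj]

theorem addNe_iff (h : B.IsIndex e) (n : B.carrier) : AddNe e n ↔ n ≠ 0 := by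
  simp [AddNe, h.mem_add_iff, Subtype.coe_inj]

variable [IsDomain B.carrier]

theorem hasQuasiInv_iff (h : B.IsIndex e) {a : B.carrier} (ha : a ≠ 0) :
    HasQuasiInv e a ↔ IsUnit a := by
  constructor
  · rintro ⟨c, hc, r, hr, har⟩
    rw [h.one_mem_iff] at hc
    lift c to B.carrier using hc
    rw [h.mem_mul_iff] at hr
    subst hr
    rw [h.mem_mul_iff, Subtype.coe_inj] at har
    refine IsUnit.of_mul_eq_one c (mul_right_cancel₀ ha ?_)
    rw [← har, one_mul]
  · intro hu
    obtain ⟨c, hc⟩ := hu.exists_right_inv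
    refine ⟨c, (h.one_mem_iff _).2 c.2, _, (h.mem_mul_iff _ _ _).2 rfl, (h.mem_mul_iff _ _ _).2 ?_⟩
    rw [hc, one_mul]

theorem mulMulNe_iff (h : B.IsIndex e) {n : B.carrier} (hn : n ≠ 0) (a : B.carrier) :
    MulMulNe e n a ↔ n * a ≠ 1 := by
  simp [MulMulNe, h.mem_mul_iff, Subtype.coe_inj, hn]

theorem mem_primes_iff [UniqueFactorizationMonoid B.carrier] (h : B.IsIndex e) (n : ℕ) :
    n ∈ B.primes ↔ ∀ a b, IrreducibleAt e n a b := by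
  constructor
  · rintro ⟨hn, hp⟩ a b
    refine ⟨(h.one_mem_iff n).2 hn, (addNe_iff h ⟨n, hn⟩).2 hp.ne_zero, ?_⟩
    by_cases ha : a ∈ B.carrier
    swap
    · exact .inl ((h.zero_mem_iff a).2 ha)
    by_cases hb : b ∈ B.carrier
    swap
    · exact .inr (.inl ((h.zero_mem_iff b).2 hb))
    refine .inr (.inr ⟨(mulMulNe_iff h hp.ne_zero ⟨a, ha⟩).2 fun h1 =>
      hp.not_isUnit (IsUnit.of_mul_eq_one _ h1), ?_⟩)
    by_cases hab : (⟨a, ha⟩ * ⟨b, hb⟩ : B.carrier) = ⟨n, hn⟩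
    swap
    · exact .inl ((mulNe_iff h ⟨n, hn⟩ ⟨a, ha⟩ ⟨b, hb⟩).2 hab)
    have h0 := hp.ne_zero
    rw [← hab, mul_ne_zero_iff] at h0
    exact .inr ((hp.irreducible.isUnit_or_isUnit hab.symm).imp
      (hasQuasiInv_iff h h0.1).2 (hasQuasiInv_iff h h0.2).2)
  · intro hall
    have hn := (h.one_mem_iff n).1 (hall 0 0).1
    lift n to B.carrier using hn
    have hn0 := (addNe_iff h n).1 (hall 0 0).2.1
    have hC : ∀ a : B.carrier, ¬ 0 ∈ e.1.eval a := fun a h0 => (h.zero_mem_iff _).1 h0 a.2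
    have hall' : ∀ a b : B.carrier, n * a ≠ 1 ∧ (a * b ≠ n ∨ HasQuasiInv e a ∨ HasQuasiInv e b) := by
      intro a b
      have := (hall a b).2.2
      rwa [or_iff_right (hC a), or_iff_right (hC b), mulMulNe_iff h hn0, mulNe_iff h] at this
    refine ⟨n.2, Irreducible.prime ⟨fun hu => ?_, fun {a b} hab => ?_⟩⟩
    · obtain ⟨c, hc⟩ := hu.exists_right_inv
      exact (hall' c 0).1 hc
    · have h0 := hn0
      change n = a * b at hab
      rw [hab, mul_ne_zero_iff] at h0
      refine ((hall' a b).2.resolve_left fun h1 => h1 hab.symm).imp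
        (hasQuasiInv_iff h h0.1).1 (hasQuasiInv_iff h h0.2).1

/-- Positive multiples of 1 can be computed uniformly in an index.  The element 1 is found as the only
nonzero idempotent. -/
theorem exists_natCast : ∃ F : Index → ℕ →. ℕ, Partrec₂ F ∧
    ∀ (B : ComputableRing) (e : Index), IsDomain B.carrier → B.IsIndex e →
      ∀ k, F e k = Part.some (((k + 1 : ℕ) : B.carrier) : ℕ) := by
  have hone : IsSigma1 fun t : Index × ℕ =>
      1 ∈ t.1.1.eval t.2 ∧ t.2 ∈ t.1.2.2.eval (Nat.pair t.2 t.2) ∧ AddNe t.1 t.2 :=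
    .and (isSigma1_mem_char Computable.fst Computable.snd 1)
      (.and (isSigma1_mem_mul Computable.fst Computable.snd Computable.snd Computable.snd)
        (isSigma1_addNe Computable.fst Computable.snd))
  obtain ⟨G, hG, hGspec⟩ := IsSigma1.exists_choice hone (p := fun e u =>
    1 ∈ e.1.eval u ∧ u ∈ e.2.2.eval (Nat.pair u u) ∧ AddNe e u)
  let H : Index × ℕ → ℕ →. ℕ := fun x u =>
    Nat.rec (Part.some u) (fun _ IH => IH.bind fun z => x.1.2.1.eval (Nat.pair z u)) x.2
  have hH : Partrec₂ H := by
    refine Partrec.nat_rec (f := fun y : (Index × ℕ) × ℕ => y.1.2) (g := fun y => Part.some y.2)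
      (h := fun y z => y.1.1.2.1.eval (Nat.pair z.2 y.2)) (Computable.snd.comp Computable.fst)
      Computable.snd.partrec ?_
    refine Code.eval_part.comp (Computable.fst.comp (Computable.snd.comp (Computable.fst.comp
      (Computable.fst.comp Computable.fst)))) (Primrec₂.natPair.to_comp.comp
        (Computable.snd.comp Computable.snd) (Computable.snd.comp Computable.fst))
  refine ⟨fun e k => (G e).bind fun u => H (e, k) u,
    (hG.comp Computable.fst).bind (hH.comp Computable.fst Computable.snd), ?_⟩
  intro B e hB h k
  obtain ⟨u, hu, hu1, hu2, hu3⟩ := hGspec e ⟨((1 : B.carrier) : ℕ),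
    (h.one_mem_iff _).2 (1 : B.carrier).2, (h.mem_mul_iff _ _ _).2 (by rw [one_mul]), (addNe_iff h _).2 one_ne_zero⟩
  rw [h.one_mem_iff] at hu1
  lift u to B.carrier using hu1
  rw [h.mem_mul_iff, Subtype.coe_inj] at hu2
  rw [addNe_iff h] at hu3
  obtain rfl : u = 1 := mul_right_cancel₀ hu3 (by rw [one_mul]; exact hu2.symm)
  change (G e).bind (fun u => H (e, k) u) = _
  rw [hu, Part.bind_some]
  induction k with
  | zero => simp [H]
  | succ k ih =>
    change (H (e, k) ((1 : B.carrier) : ℕ)).bind _ = _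
    rw [ih, Part.bind_some]
    change e.2.1.eval _ = _
    rw [h.add]
    push_cast
    rfl

end ComputableRing

/-! ### The ring and the completeness of its primes -/

open Laurent in
/-- A computable unique factorization domain whose prime numbers code the universal `Π⁰₂` set. -/
theorem exists_computableRing_prime_iff :
    ∃ A : ComputableRing, IsDomain A.carrier ∧ UniqueFactorizationMonoid A.carrier ∧
      CharZero A.carrier ∧
      ∀ i, Prime ((primeSeq i : ℕ) : A.carrier) ↔ i ∈ universalPi2 := by
  have hp : ∀ j : ℕ, (primeSeq j.unpair.1).Prime := fun j => prime_primeSeq _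
  have hinj : Set.InjOn (fun j : ℕ => primeSeq j.unpair.1) failures :=
    primeSeq_injective.injOn.comp injOn_failures fun _ _ => Set.mem_univ _
  obtain ⟨A, ⟨φ⟩⟩ := exists_computableRing_weightRing prime_primeSeq primeSeq_injective
    primrec_primeSeq (Primrec.fst.comp Primrec.unpair) primrec_seenOut mem_failures_iff
    injOn_failures
  have hU := uniqueFactorizationMonoid_weightRing hp hinj
  have hchar : CharZero (weightRing failures fun j => primeSeq j.unpair.1) := ⟨fun m n h => by
    have h' := congrArg (fun f => AddMonoidAlgebra.coeff (Subtype.val f) 0) h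
    simpa [AddMonoidAlgebra.natCast_def] using h'⟩
  refine ⟨A, φ.toMulEquiv.isDomain _, φ.toMulEquiv.symm.uniqueFactorizationMonoid hU,
    ⟨fun m n h => ?_⟩, fun i => ?_⟩
  · have := congrArg φ h
    rw [map_natCast, map_natCast] at this
    exact Nat.cast_injective this
  · rw [← MulEquiv.prime_iff φ, map_natCast]
    constructor
    · intro h
      by_contra hi
      obtain ⟨j, hj, rfl⟩ := (exists_failures_iff i).2 hi
      exact not_prime_natCast hp hj h
    · intro hi
      refine prime_natCast_weightRing hp (prime_primeSeq i) fun j hj h => ?_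
      exact (exists_failures_iff i).1 ⟨j, hj, primeSeq_injective h⟩ hi

/-- Fixing the index turns uniform completeness into completeness. -/
theorem UniformlyPi2Complete.isPi2Complete {I : Type} [Primcodable I] {S : I → Set ℕ → Prop}
    (h : UniformlyPi2Complete S) {e : I} {P : Set ℕ} (he : S e P) : IsPi2Complete P := by
  obtain ⟨⟨R, hR, hRS⟩, hred⟩ := h
  refine ⟨⟨R e, ?_, hRS e P he⟩, fun Z hZ => ?_⟩
  · classical
    exact Computable.computablePred (hR.decide.comp ((Computable.const e).pair Computable.id))
  · obtain ⟨f, hf, hfS⟩ := hred Z hZ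
    obtain ⟨g, hg, hginj, hgZ⟩ := hfS e P he
    refine ⟨g, ?_, hginj, hgZ⟩
    exact (hf.comp (Computable.const e) Computable.id).of_eq_tot fun i => by
      change g i ∈ f e i
      rw [hg]
      exact Part.mem_some _

theorem corollary1p6 :
    ∃ A : ComputableRing,
      IsDomain A.carrier ∧ UniqueFactorizationMonoid A.carrier ∧
      (∀ B : ComputableRing, B.IsPresentationOf A.carrier → IsPi2Complete B.primes) ∧
      UniformlyPi2Complete (fun (e : ComputableRing.Index) (P : Set ℕ) =>
        ∃ B : ComputableRing, B.IsPresentationOf A.carrier ∧ B.IsIndex e ∧ B.primes = P) := by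
  obtain ⟨A, hdom, hufm, hchar, hprime⟩ := exists_computableRing_prime_iff
  have huniform : UniformlyPi2Complete (fun (e : ComputableRing.Index) (P : Set ℕ) =>
      ∃ B : ComputableRing, B.IsPresentationOf A.carrier ∧ B.IsIndex e ∧ B.primes = P) := by
    refine ⟨?_, fun Z hZ => ?_⟩
    · have hsigma : IsSigma1 fun t : ComputableRing.Index × ℕ × ℕ =>
          ComputableRing.IrreducibleAt t.1 t.2.2 t.2.1.unpair.1 t.2.1.unpair.2 := by
        have hx : Computable fun t : ComputableRing.Index × ℕ × ℕ => t.2.1.unpair :=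
          Computable.unpair.comp (Computable.fst.comp Computable.snd)
        exact ComputableRing.isSigma1_irreducibleAt Computable.fst
          (Computable.snd.comp Computable.snd) (Computable.fst.comp hx) (Computable.snd.comp hx)
      obtain ⟨R, hR, hRspec⟩ := hsigma
      refine ⟨fun e x y n => R (e, x, n) y, ?_, ?_⟩
      · have h0 : Computable fun t : ComputableRing.Index × ℕ × ℕ × ℕ =>
            ((t.1, t.2.1, t.2.2.2), t.2.2.1) :=
          (Computable.fst.pair ((Computable.fst.comp Computable.snd).pair
            (Computable.snd.comp (Computable.snd.comp Computable.snd)))).pair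
            (Computable.fst.comp (Computable.snd.comp Computable.snd))
        refine Computable.computablePred ?_
        simpa using Computable.comp hR h0
      · rintro e _ ⟨B, ⟨ψ⟩, he, rfl⟩ n
        have : IsDomain B.carrier := ψ.toMulEquiv.isDomain _
        have : UniqueFactorizationMonoid B.carrier :=
          ψ.toMulEquiv.symm.uniqueFactorizationMonoid hufm
        rw [ComputableRing.mem_primes_iff he]
        refine ⟨fun h x => (hRspec (e, x, n)).1 (h _ _), fun h a b => ?_⟩
        simpa using (hRspec (e, Nat.pair a b, n)).2 (h _)
    · obtain ⟨c, hc⟩ := exists_index_universalPi2 hZ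
      obtain ⟨F, hF, hFspec⟩ := ComputableRing.exists_natCast
      have hk : Computable fun i => primeSeq (Nat.pair c i) - 1 :=
        (Primrec.nat_sub.comp (primrec_primeSeq.comp (Primrec₂.natPair.comp (Primrec.const c)
          Primrec.id)) (Primrec.const 1)).to_comp
      refine ⟨fun e i => F e (primeSeq (Nat.pair c i) - 1),
        hF.comp Computable.fst (hk.comp Computable.snd), ?_⟩
      rintro e _ ⟨B, ⟨ψ⟩, he, rfl⟩
      have hB : IsDomain B.carrier := ψ.toMulEquiv.isDomain _
      refine ⟨fun i => ((primeSeq (Nat.pair c i) : ℕ) : B.carrier), fun i => ?_, fun i j h => ?_,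
        fun i => ?_⟩
      · refine (hFspec B e hB he _).trans ?_
        rw [Nat.sub_add_cancel (prime_primeSeq _).one_lt.le]
      · have h1 := congrArg ψ (Subtype.coe_inj.1 h)
        rw [map_natCast, map_natCast] at h1
        have h2 := primeSeq_injective (Nat.cast_injective h1)
        exact (Nat.pair_eq_pair.1 h2).2
      · rw [hc, ← hprime, ← map_natCast ψ, MulEquiv.prime_iff ψ]
        exact ⟨fun h => ⟨Subtype.coe_prop _, h⟩, fun ⟨_, h⟩ => h⟩
  refine ⟨A, hdom, hufm, fun B hB => ?_, huniform⟩
  obtain ⟨e, he⟩ := B.exists_isIndex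
  exact huniform.isPi2Complete (e := e) ⟨B, hB, he, rfl⟩
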